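/- Let $d\ge 1$, $\mathcal X=[-1,1]^d$, and let $\mathbb N=\{1,2,\dots\}$. For a Borel set $\Omega\subseteq\mathbb R^{d+1}$ let $\mathcal M(\Omega)$ be the finite signed Borel (Radon) measures on $\Omega$, with total variation $|\mu|$. For $s\in\mathbb N$ put $\mathrm{RePU}_s(x)=\max(0,x)^s$. An activation is a function $\sigma:\mathbb R\to\mathbb R$ that is Lipschitz or equal to some $\mathrm{RePU}_s$. For $f:\mathcal X\to\mathbb R$ define $$\|f\|_{\mathcal B_\sigma(\Omega)}=\inf_\mu\int_\Omega \omega_\sigma(w,b)\,d|\mu|(w,b),$$ the infimum being over all $\mu\in\mathcal M(\Omega)$ with $f(x)=\int_\Omega\sigma(\langle x,w\rangle+b)\,d\mu(w,b)$ for all $x\in\mathcal X$, where $\omega_\sigma(w,b)=(\|w\|_{\ell^1}+|b|)^s$ if $\sigma=\mathrm{RePU}_s$, and $\omega_\sigma(w,b)=1+\|w\|_{\ell^1}+|b|$ for every other $\sigma$. Let $\mathcal B_\sigma(\Omega)=\{f:\|f\|_{\mathcal B_\sigma(\Omega)}<\infty\}$. For $f\in L^1(\mathcal X)$ real-valued let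 $$\|f\|_{\mathcal B_{\mathscr F,s}}=\inf_{f_e}\int_{\mathbb R^d}(1+\|\xi\|_{\ell^1})^s|\hat f_e(\xi)|\,d\xi,\qquad \hat f_e(\xi)=(2\pi)^{-d}\int_{\mathbb R^d} e^{-i\langle x,\xi\rangle}f_e(x)\,dx,$$ the infimum being over all $f_e\in L^1(\mathbb R^d)$ (complex-valued) with $f_e=f$ almost everywhere on $\mathcal X$, and let $\mathcal B_{\mathscr F,s}$ be the set of $f\in L^1(\mathcal X)$ for which this is finite. Write $A\hookrightarrow B$ if $A\subseteq B$ and there is a constant $C$ with $\|f\|_B\le C\|f\|_A$ for all $f\in A$. $D^k$ denotes the weak derivative of order $k$. Theorem. Let $\Omega,\Omega'\subseteq\mathbb R^{d+1}$ be Borel sets such that $\Omega'$ is a neighbourhood of $0$ (for instance $\Omega'=\mathbb R^{d+1}$). 1. If $\psi,\phi$ are Lipschitz and $\phi(x)=\int_{\mathbb R^2}\psi(xw+b)\,d\gamma(w,b)$ for all $x\in\mathbb R$ and some $\gamma\in\mathcal M(\mathbb R^2)$ with $\int_{\mathbb R^2}(1+|w|+|b|)\,d|\gamma|(w,b)<\infty$,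 then $\mathcal B_\phi(\Omega)\hookrightarrow\mathcal B_\psi(\mathbb R^{d+1})$. 2. If $\psi$ is Lipschitz, $\psi\in C^1(\mathbb R)$ and $D^2\psi\in L^1(\mathbb R)$, then $\mathcal B_\psi(\Omega)\hookrightarrow\mathcal B_{\mathrm{RePU}_1}(\Omega')$. 3. If $s\in\mathbb N$, $\psi$ is Lipschitz, $\psi\in C^s(\mathbb R)$, $D^{s+1}\psi\in L^1(\mathbb R)$ and $\Omega$ is bounded, then $\mathcal B_\psi(\Omega)\hookrightarrow\mathcal B_{\mathrm{RePU}_s}(\Omega')$. 4. If $s,t\in\mathbb N$ and $t\le s$, then $\mathcal B_{\mathrm{RePU}_s}(\Omega)\hookrightarrow\mathcal B_{\mathrm{RePU}_t}(\Omega')$. 5. If $s\in\mathbb N$, then $\mathcal B_{\mathscr F,s+1}\hookrightarrow\mathcal B_{\mathrm{RePU}_s}(\Omega')$. Here each class in $\mathcal B_{\mathscr F,s+1}\subseteq L^1(\mathcal X)$ is identified with its unique representative in $\mathcal B_{\mathrm{RePU}_s}(\Omega')$. -/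

import Mathlib

open MeasureTheory
open scoped NNReal Topology ContDiff

noncomputable section

/-- The input domain `𝒳 = [-1,1]^d`. -/
def cube (d : ℕ) : Set (EuclideanSpace ℝ (Fin d)) := {x | ∀ i, |x i| ≤ 1}

/-- Lebesgue measure on `[-1,1]^d`. -/
def cubeMeasure (d : ℕ) : Measure (cube d) := Measure.comap Subtype.val volume

/-- The parameter space `ℝ^{d+1}`, whose elements are the pairs `(w, b)` of a weight and a bias. -/
abbrev Param (d : ℕ) : Type := EuclideanSpace ℝ (Fin d) × ℝ

/-- The `ℓ¹` norm on `ℝ^d` (the norm of `EuclideanSpace` is the `ℓ²` norm). -/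
def l1norm {d : ℕ} (w : EuclideanSpace ℝ (Fin d)) : ℝ := ∑ i, |w i|

/-- The rectified power unit `max(0,x)^s`; the rectified linear unit is the case `s = 1`. -/
def repu (s : ℕ) (x : ℝ) : ℝ := max 0 x ^ s

/-- The neuron `⟨x, w⟩ + b` before the activation. -/
def preact {d : ℕ} (x : EuclideanSpace ℝ (Fin d)) (p : Param d) : ℝ := inner ℝ x p.1 + p.2

/-- `μ` represents `f` through `σ`:
`f x = ∫ σ(⟨x,w⟩ + b) dμ(w,b)` for all `x ∈ [-1,1]^d`, the integrals being convergent.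
For Borel `Ω`, the finite signed Borel measures on `Ω` are exactly its signed Radon measures. -/
def Represents {d : ℕ} (Ω : Set (Param d)) (σ : ℝ → ℝ) (f : cube d → ℝ)
    (μ : SignedMeasure Ω) : Prop :=
  ∀ x : cube d, μ.Integrable (fun p : Ω => σ (preact x.1 p.1)) ∧
    f x = ∫ᵛ p : Ω, σ (preact x.1 p.1) ∂<•μ

open Classical in
/-- The weight in the Barron norm: `(‖w‖₁ + |b|)^s` if `σ` is the rectified power unit of
order `s ≥ 1` (such an `s` is unique), and `1 + ‖w‖₁ + |b|` for every other activation. -/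
def barronWeight {d : ℕ} (σ : ℝ → ℝ) (p : Param d) : ℝ :=
  if h : ∃ s : ℕ, 1 ≤ s ∧ σ = repu s then (l1norm p.1 + |p.2|) ^ h.choose
  else 1 + l1norm p.1 + |p.2|

theorem repu_injective {s t : ℕ} (h : repu s = repu t) : s = t := by
  have h2 := congrFun h 2
  simp only [repu, max_eq_right (show (0 : ℝ) ≤ 2 by norm_num)] at h2
  exact pow_right_injective₀ (by norm_num) (by norm_num) h2

theorem barronWeight_repu {d s : ℕ} (hs : 1 ≤ s) (p : Param d) :
    barronWeight (repu s) p = (l1norm p.1 + |p.2|) ^ s := by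
  have h : ∃ t : ℕ, 1 ≤ t ∧ repu s = repu t := ⟨s, hs, rfl⟩
  rw [barronWeight, dif_pos h, ← repu_injective h.choose_spec.2]

/-- The Barron norm, with value `⊤` if there is no representing measure of finite weight. -/
def barronNorm {d : ℕ} (Ω : Set (Param d)) (σ : ℝ → ℝ) (f : cube d → ℝ) : ENNReal :=
  ⨅ (μ : SignedMeasure Ω) (_ : Represents Ω σ f μ),
    ∫⁻ p : Ω, ENNReal.ofReal (barronWeight σ p.1) ∂μ.variation

/-- The Barron space with activation `σ` and parameter set `Ω`. -/
def barronSpace {d : ℕ} (Ω : Set (Param d)) (σ : ℝ → ℝ) : Set (cube d → ℝ) :=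
  {f | barronNorm Ω σ f < ⊤}

/-- The embedding of the Barron space of `(Ω, σ)` into that of `(Ω', τ)`: inclusion, and a bound
of the norms with a constant independent of the function. -/
def BarronEmbeds {d : ℕ} (Ω : Set (Param d)) (σ : ℝ → ℝ) (Ω' : Set (Param d)) (τ : ℝ → ℝ) : Prop :=
  barronSpace Ω σ ⊆ barronSpace Ω' τ ∧
    ∃ C : ℝ≥0, ∀ f ∈ barronSpace Ω σ, barronNorm Ω' τ f ≤ C * barronNorm Ω σ f

/-- `g` is the weak derivative of order `n` of `f` on the real line. -/
def HasWeakDeriv (n : ℕ) (f g : ℝ → ℝ) : Prop :=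
  LocallyIntegrable f volume ∧ LocallyIntegrable g volume ∧
    ∀ η : ℝ → ℝ, ContDiff ℝ ∞ η → HasCompactSupport η →
      ∫ x, f x * iteratedDeriv n η x = (-1) ^ n * ∫ x, g x * η x

/-- The weak derivative of order `n` of `f` exists and is an `L¹` function. -/
def WeakDerivInL1 (n : ℕ) (f : ℝ → ℝ) : Prop :=
  ∃ g : ℝ → ℝ, Integrable g volume ∧ HasWeakDeriv n f g

/-- The Fourier transform `(2π)^{-d} ∫ e^{-i⟨x,ξ⟩} F(x) dx`. -/
def fourierHat {d : ℕ} (F : EuclideanSpace ℝ (Fin d) → ℂ) (ξ : EuclideanSpace ℝ (Fin d)) : ℂ :=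
  (((2 * Real.pi) ^ d)⁻¹ : ℝ) *
    ∫ x, Complex.exp (-Complex.I * ((inner ℝ x ξ : ℝ) : ℂ)) * F x

/-- `F ∈ L¹(ℝ^d)` is an extension of `f ∈ L¹([-1,1]^d)`. -/
def IsL1Extension {d : ℕ} (f : Lp ℝ 1 (cubeMeasure d))
    (F : EuclideanSpace ℝ (Fin d) → ℂ) : Prop :=
  Integrable F volume ∧ ∀ᵐ x ∂cubeMeasure d, F x.1 = ((f x : ℝ) : ℂ)

/-- The spectral Barron norm of order `s`. -/
def spectralBarronNorm {d : ℕ} (s : ℕ) (f : Lp ℝ 1 (cubeMeasure d)) : ENNReal :=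
  ⨅ (F : EuclideanSpace ℝ (Fin d) → ℂ) (_ : IsL1Extension f F),
    ∫⁻ ξ, ENNReal.ofReal ((1 + l1norm ξ) ^ s) * ‖fourierHat F ξ‖ₑ

/-- The spectral Barron space of order `s`. -/
def spectralBarronSpace (d s : ℕ) : Set (Lp ℝ 1 (cubeMeasure d)) :=
  {f | spectralBarronNorm s f < ⊤}

/-- The embedding of the spectral Barron space of order `s` into the Barron space of `(Ω, τ)`.
The first is a space of classes of functions modulo null sets, the second a space of
functions, so the inclusion means that each class has exactly one member in the second space. -/
def SpectralEmbeds {d : ℕ} (s : ℕ) (Ω : Set (Param d)) (τ : ℝ → ℝ) : Prop :=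
  (∀ f ∈ spectralBarronSpace d s, ∃! g : cube d → ℝ, g ∈ barronSpace Ω τ ∧ g =ᵐ[cubeMeasure d] f) ∧
    ∃ C : ℝ≥0, ∀ f ∈ spectralBarronSpace d s, ∀ g ∈ barronSpace Ω τ, g =ᵐ[cubeMeasure d] f →
      barronNorm Ω τ g ≤ C * spectralBarronNorm s f

end

/-! Every embedding comes from writing one source neuron as a superposition of target neurons and
inserting this into the representing integral. A signed measure is a density of modulus one against
its variation, so by Fubini the result is an ordinary integral over a product of the old parameters
and the new variables. `barronNorm_le_lintegral` bounds the Barron norm by the weight of any such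
superposition, over an arbitrary measure space. It remains to count how the weight grows with the
norm R = ‖w‖₁ + |b|, which dominates |⟨x,w⟩ + b| on the cube.

If the target is a rectified power unit, homogeneity rescales all parameters to a small sphere at no
cost, so any neighbourhood of 0 serves as Ω'.

The neurons are decomposed as follows. For Lipschitz φ represented by ψ, each neuron φ(⟨x,w⟩ + b) is
a superposition of neurons ψ(q₁(⟨x,w⟩ + b) + q₂), and 1 + R is submultiplicative under this
composition. For `repu (s + 1)`, one has repu (s+1) z = (s+1) ∫₀ᴿ repu s (z - t) dt whenever z ≤ R;
the integral costs one factor R. For smooth ψ, Taylor's formula at 0 with integral remainder gives,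
on |z| ≤ R, a polynomial of degree at most s plus integrals over 0 < t ≤ R of repu s (±z - t)
against the derivative of order s + 1. The polynomial is a finite sum of shifted units. The cost is
(1 + R)^s times the integral of that derivative's modulus over [-R, R]: a constant if the derivative
is in L¹, and O(1 + R) if it is bounded. For spectral Barron functions, Fourier inversion writes f
as a superposition of cosines and sines of ⟨x,ξ⟩. Their derivatives are bounded, so the total cost
is (1 + ‖ξ‖₁)^(s+1). -/

/-! ### Signed measures as densities against their variation -/

/-- The density is the sign given by a Hahn decomposition. It turns integrals against a signed
measure into Bochner integrals, to which Fubini and dominated convergence apply. -/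
theorem SignedMeasure.exists_density_variation {X : Type*} [MeasurableSpace X]
    (μ : SignedMeasure X) :
    ∃ h : X → ℝ, Measurable h ∧ (∀ x, |h x| = 1) ∧ ∀ f : X → ℝ, Integrable f μ.variation →
      ∫ᵛ x, f x ∂<•μ = ∫ x, h x * f x ∂μ.variation := by
  classical
  obtain ⟨i, hi, hpos, hneg, hp, hn⟩ := μ.toJordanDecomposition_spec
  set p := μ.toJordanDecomposition.posPart with hpdef
  set n := μ.toJordanDecomposition.negPart with hndef
  have hvar : μ.variation = p + n := by
    rw [← SignedMeasure.totalVariation_eq_variation]; rfl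
  have hμ : μ = p.toSignedMeasure - n.toSignedMeasure :=
    (SignedMeasure.toSignedMeasure_toJordanDecomposition μ).symm
  have hpi : p iᶜ = 0 := by
    rw [hp, SignedMeasure.toMeasureOfZeroLE_apply _ _ _ hi.compl]; simp
  have hni : n i = 0 := by
    rw [hn, SignedMeasure.toMeasureOfLEZero_apply _ _ _ hi]; simp
  refine ⟨fun x => if x ∈ i then 1 else -1, Measurable.ite hi measurable_const measurable_const,
    fun x => by by_cases hx : x ∈ i <;> simp [hx], fun f hf => ?_⟩
  rw [hvar] at hf
  obtain ⟨hfp, hfn⟩ := integrable_add_measure.1 hf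
  have hh : Measurable (fun x => if x ∈ i then (1 : ℝ) else -1) :=
    Measurable.ite hi measurable_const measurable_const
  have ep : (fun x => (if x ∈ i then (1 : ℝ) else -1) * f x) =ᵐ[p] f := by
    have : ∀ᵐ x ∂p, x ∈ i := by rw [ae_iff]; exact hpi
    filter_upwards [this] with x hx
    simp [hx]
  have en : (fun x => (if x ∈ i then (1 : ℝ) else -1) * f x) =ᵐ[n] fun x => - f x := by
    have : ∀ᵐ x ∂n, x ∉ i := by rw [ae_iff]; simpa using hni
    filter_upwards [this] with x hx
    simp [hx]
  rw [hvar, integral_add_measure (hfp.congr ep.symm) (hfn.neg.congr en.symm),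
    integral_congr_ae ep, integral_congr_ae en, integral_neg]
  conv_lhs => rw [hμ]
  rw [VectorMeasure.integral_sub_vectorMeasure]
  · simp [sub_eq_add_neg]
  · simpa [VectorMeasure.Integrable] using hfp
  · simpa [VectorMeasure.Integrable] using hfn

/-! ### Norms of parameters and elementary bounds for neurons -/

theorem continuous_l1norm {d : ℕ} : Continuous (l1norm (d := d)) := by
  unfold l1norm; fun_prop

theorem l1norm_nonneg {d : ℕ} (w : EuclideanSpace ℝ (Fin d)) : 0 ≤ l1norm w :=
  Finset.sum_nonneg fun _ _ => abs_nonneg _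

theorem l1norm_smul {d : ℕ} (c : ℝ) (w : EuclideanSpace ℝ (Fin d)) :
    l1norm (c • w) = |c| * l1norm w := by
  simp [l1norm, abs_mul, Finset.mul_sum]

theorem norm_le_l1norm {d : ℕ} (w : EuclideanSpace ℝ (Fin d)) : ‖w‖ ≤ l1norm w := by
  rw [EuclideanSpace.norm_eq]
  apply Real.sqrt_le_iff.2 ⟨l1norm_nonneg w, ?_⟩
  simpa [l1norm] using Finset.sum_sq_le_sq_sum_of_nonneg (s := Finset.univ) (f := fun i => |w i|)
    (fun i _ => abs_nonneg _)

/-- The norm `‖w‖₁ + |b|` of a parameter `(w, b)`. -/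
def paramNorm {d : ℕ} (p : Param d) : ℝ := l1norm p.1 + |p.2|

theorem paramNorm_nonneg {d : ℕ} (p : Param d) : 0 ≤ paramNorm p :=
  add_nonneg (l1norm_nonneg _) (abs_nonneg _)

theorem continuous_paramNorm {d : ℕ} : Continuous (paramNorm (d := d)) :=
  (continuous_l1norm.comp continuous_fst).add continuous_snd.abs

theorem paramNorm_smul {d : ℕ} (c : ℝ) (p : Param d) : paramNorm (c • p) = |c| * paramNorm p := by
  simp [paramNorm, l1norm_smul, abs_mul, mul_add]

theorem norm_le_paramNorm {d : ℕ} (p : Param d) : ‖p‖ ≤ paramNorm p := by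
  rw [Prod.norm_def]
  apply max_le
  · exact (norm_le_l1norm _).trans (le_add_of_nonneg_right (abs_nonneg _))
  · exact le_add_of_nonneg_left (l1norm_nonneg _)

theorem continuous_preact {d : ℕ} :
    Continuous fun q : EuclideanSpace ℝ (Fin d) × Param d => preact q.1 q.2 := by
  unfold preact; fun_prop

theorem preact_smul {d : ℕ} (x : EuclideanSpace ℝ (Fin d)) (c : ℝ) (p : Param d) :
    preact x (c • p) = c * preact x p := by
  simp [preact, inner_smul_right, mul_add]

theorem preact_affine {d : ℕ} (x : EuclideanSpace ℝ (Fin d)) (e c : ℝ) (p : Param d) :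
    preact x (e • p.1, e * p.2 + c) = e * preact x p + c := by
  simp [preact, inner_smul_right, mul_add, add_assoc]

theorem abs_preact_le {d : ℕ} (x : cube d) (p : Param d) : |preact x.1 p| ≤ paramNorm p := by
  unfold preact paramNorm
  refine (abs_add_le _ _).trans (add_le_add_left ?_ _)
  rw [PiLp.inner_apply]
  refine (Finset.abs_sum_le_sum_abs _ _).trans (Finset.sum_le_sum fun i _ => ?_)
  have := x.2 i
  simp only [RCLike.inner_apply, conj_trivial, abs_mul]
  exact mul_le_of_le_one_right (abs_nonneg _) this

theorem continuous_repu (s : ℕ) : Continuous (repu s) := by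
  unfold repu; fun_prop

theorem repu_nonneg (s : ℕ) (x : ℝ) : 0 ≤ repu s x := pow_nonneg (le_max_left _ _) _

theorem abs_repu_le (s : ℕ) (x : ℝ) : |repu s x| ≤ |x| ^ s := by
  rw [abs_of_nonneg (repu_nonneg s x)]
  exact pow_le_pow_left₀ (le_max_left _ _) (max_le (abs_nonneg _) (le_abs_self _)) _

theorem repu_mul (s : ℕ) {c : ℝ} (hc : 0 ≤ c) (x : ℝ) : repu s (c * x) = c ^ s * repu s x := by
  rw [repu, repu, ← mul_pow, mul_max_of_nonneg _ _ hc, mul_zero]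

theorem abs_repu_preact_le {d : ℕ} (s : ℕ) (x : cube d) (p : Param d) :
    |repu s (preact x.1 p)| ≤ paramNorm p ^ s :=
  (abs_repu_le _ _).trans (pow_le_pow_left₀ (abs_nonneg _) (abs_preact_le x p) _)

theorem measurable_barronWeight {d : ℕ} (σ : ℝ → ℝ) : Measurable (barronWeight (d := d) σ) := by
  have h1 := (continuous_paramNorm (d := d)).measurable
  have h2 := (continuous_l1norm (d := d)).measurable
  unfold paramNorm at h1
  unfold barronWeight
  split_ifs
  · exact h1.pow_const _
  · fun_prop

/-! ### Barron norms of superpositions of neurons -/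

/-- The positive and negative parts of the density are pushed forward to Ω and subtracted. Their
images may overlap and cancel, so the variation is only bounded by the sum. Leaving the measure
space free allows extra integration variables. -/
theorem barronNorm_le_lintegral {d : ℕ} {A : Type*} [MeasurableSpace A] (ν : Measure A)
    {h : A → ℝ} (hm : Measurable h) (hint : Integrable h ν) {T : A → Param d} (hT : Measurable T)
    {Ω : Set (Param d)} (hTΩ : ∀ a, T a ∈ Ω) {σ : ℝ → ℝ} (hσ : Continuous σ) {f : cube d → ℝ}
    (hi : ∀ x : cube d, Integrable (fun a => h a * σ (preact x.1 (T a))) ν)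
    (hf : ∀ x : cube d, f x = ∫ a, h a * σ (preact x.1 (T a)) ∂ν) :
    barronNorm Ω σ f ≤ ∫⁻ a, ‖h a‖ₑ * ENNReal.ofReal (barronWeight σ (T a)) ∂ν := by
  set S : A → Ω := fun a => ⟨T a, hTΩ a⟩
  have hS : Measurable S := hT.subtype_mk
  set p := ν.withDensity (fun a => ENNReal.ofReal (h a)) with hp
  set n := ν.withDensity (fun a => ENNReal.ofReal (-h a)) with hn
  have hmp : Measurable (fun a => ENNReal.ofReal (h a)) := hm.ennreal_ofReal
  have hmn : Measurable (fun a => ENNReal.ofReal (-h a)) := hm.neg.ennreal_ofReal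
  have : IsFiniteMeasure p := isFiniteMeasure_withDensity_ofReal hint.2
  have : IsFiniteMeasure n := isFiniteMeasure_withDensity_ofReal hint.neg.2
  set μ : SignedMeasure Ω := (p.map S).toSignedMeasure - (n.map S).toSignedMeasure with hμ
  have hvar : μ.variation ≤ p.map S + n.map S := by
    refine VectorMeasure.variation_sub_le.trans ?_
    simp
  have hsum : p + n = ν.withDensity (fun a => ‖h a‖ₑ) := by
    rw [hp, hn, ← withDensity_add_left hmp]
    congr 1
    ext a
    simp only [Pi.add_apply]
    rcases le_total 0 (h a) with h0 | h0
    · rw [ENNReal.ofReal_of_nonpos (by linarith : -h a ≤ 0), add_zero, Real.enorm_of_nonneg h0]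
    · rw [ENNReal.ofReal_of_nonpos h0, zero_add, ← enorm_neg, Real.enorm_of_nonneg (by linarith)]
  have hσx (x : cube d) : Continuous fun q : Ω => σ (preact x.1 q) :=
    hσ.comp (continuous_preact.comp (continuous_const.prodMk continuous_subtype_val))
  have hσm (x : cube d) : Measurable fun a => σ (preact x.1 (T a)) :=
    (hσx x).measurable.comp hS
  have hpn (x : cube d) : Integrable (fun a => σ (preact x.1 (T a))) (p + n) := by
    rw [hsum]
    refine ⟨(hσm x).aestronglyMeasurable, ?_⟩
    have := (hi x).2
    rw [hasFiniteIntegral_iff_enorm] at this ⊢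
    rw [lintegral_withDensity_eq_lintegral_mul _ hm.enorm (hσm x).enorm]
    simpa [enorm_mul] using this
  have hip (x : cube d) : Integrable (fun q : Ω => σ (preact x.1 q)) (p.map S) := by
    rw [integrable_map_measure (hσx x).aestronglyMeasurable hS.aemeasurable]
    exact (integrable_add_measure.1 (hpn x)).1
  have hin (x : cube d) : Integrable (fun q : Ω => σ (preact x.1 q)) (n.map S) := by
    rw [integrable_map_measure (hσx x).aestronglyMeasurable hS.aemeasurable]
    exact (integrable_add_measure.1 (hpn x)).2
  have hrep : Represents Ω σ f μ := by
    intro x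
    refine ⟨((integrable_add_measure.2 ⟨hip x, hin x⟩)).mono_measure hvar, ?_⟩
    rw [hμ, VectorMeasure.integral_sub_vectorMeasure]
    · rw [VectorMeasure.integral_toSignedMeasure, VectorMeasure.integral_toSignedMeasure,
        integral_map hS.aemeasurable (hσx x).aestronglyMeasurable,
        integral_map hS.aemeasurable (hσx x).aestronglyMeasurable, hf x, hp, hn,
        integral_withDensity_eq_integral_toReal_smul hmp (by simp),
        integral_withDensity_eq_integral_toReal_smul hmn (by simp), ← integral_sub]
      · refine integral_congr_ae (.of_forall fun a => ?_)
        simp only [S, smul_eq_mul, ENNReal.toReal_ofReal']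
        rw [← sub_mul, max_comm, max_comm (-h a)]
        congr 1
        rcases le_total 0 (h a) with h0 | h0
        · rw [max_eq_right h0, max_eq_left (by linarith)]; ring
        · rw [max_eq_left h0, max_eq_right (by linarith)]; ring
      · exact (integrable_withDensity_iff_integrable_smul' hmp (by simp)).1
          (integrable_add_measure.1 (hpn x)).1
      · exact (integrable_withDensity_iff_integrable_smul' hmn (by simp)).1
          (integrable_add_measure.1 (hpn x)).2
    · simpa [VectorMeasure.Integrable] using hip x
    · simpa [VectorMeasure.Integrable] using hin x
  have hw : Measurable fun q : Ω => ENNReal.ofReal (barronWeight σ q.1) :=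
    ((measurable_barronWeight σ).comp measurable_subtype_coe).ennreal_ofReal
  refine (iInf₂_le μ hrep).trans ((lintegral_mono' hvar le_rfl).trans ?_)
  rw [← Measure.map_add _ _ hS, lintegral_map hw hS, hsum,
    lintegral_withDensity_eq_lintegral_mul (f := fun a => ‖h a‖ₑ) ν hm.enorm
      (g := fun a => ENNReal.ofReal (barronWeight σ (S a).1)) (hw.comp hS)]
  rfl

theorem Represents.add {d : ℕ} {Ω : Set (Param d)} {σ : ℝ → ℝ} {f g : cube d → ℝ}
    {μ ν : SignedMeasure Ω} (hμ : Represents Ω σ f μ) (hν : Represents Ω σ g ν) :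
    Represents Ω σ (f + g) (μ + ν) := fun x =>
  ⟨((integrable_add_measure.2 ⟨(hμ x).1, (hν x).1⟩)).mono_measure VectorMeasure.variation_add_le, by
    rw [VectorMeasure.integral_add_vectorMeasure (hμ x).1 (hν x).1, ← (hμ x).2, ← (hν x).2]; rfl⟩

theorem barronNorm_add_le {d : ℕ} (Ω : Set (Param d)) (σ : ℝ → ℝ) (f g : cube d → ℝ) :
    barronNorm Ω σ (f + g) ≤ barronNorm Ω σ f + barronNorm Ω σ g := by
  rcases eq_or_ne (barronNorm Ω σ f) ⊤ with hf | hf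
  · simp [hf]
  rcases eq_or_ne (barronNorm Ω σ g) ⊤ with hg | hg
  · simp [hg]
  refine ENNReal.le_of_forall_pos_le_add fun ε hε _ => ?_
  have hε2 : ((ε / 2 : ℝ≥0) : ENNReal) ≠ 0 := by positivity
  obtain ⟨μ, hμ⟩ := iInf_lt_iff.1 (ENNReal.lt_add_right hf hε2)
  obtain ⟨hμr, hμ⟩ := iInf_lt_iff.1 hμ
  obtain ⟨ν, hν⟩ := iInf_lt_iff.1 (ENNReal.lt_add_right hg hε2)
  obtain ⟨hνr, hν⟩ := iInf_lt_iff.1 hν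
  refine (iInf₂_le (μ + ν) (hμr.add hνr)).trans ?_
  refine (lintegral_mono' VectorMeasure.variation_add_le le_rfl).trans ?_
  rw [lintegral_add_measure]
  refine (add_le_add hμ.le hν.le).trans (le_of_eq ?_)
  rw [add_add_add_comm, ← ENNReal.coe_add, add_halves]
  rfl

theorem barronNorm_zero {d : ℕ} (Ω : Set (Param d)) (σ : ℝ → ℝ) :
    barronNorm Ω σ (0 : cube d → ℝ) = 0 := by
  refine le_antisymm ((iInf₂_le (0 : SignedMeasure Ω) fun x => ?_).trans ?_) bot_le
  · constructor
    · simp [VectorMeasure.Integrable]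
    · simp
  · simp

theorem barronNorm_sum_le {d : ℕ} (Ω : Set (Param d)) (σ : ℝ → ℝ) {ι : Type*} (t : Finset ι)
    (f : ι → cube d → ℝ) : barronNorm Ω σ (∑ i ∈ t, f i) ≤ ∑ i ∈ t, barronNorm Ω σ (f i) := by
  classical
  induction t using Finset.induction_on with
  | empty => simp [barronNorm_zero]
  | insert i t hi ih =>
    rw [Finset.sum_insert hi, Finset.sum_insert hi]
    exact (barronNorm_add_le _ _ _ _).trans (add_le_add_right ih _)

theorem exists_density_of_represents {d : ℕ} {Ω : Set (Param d)} {σ : ℝ → ℝ} {f : cube d → ℝ}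
    {μ : SignedMeasure Ω} (hμ : Represents Ω σ f μ) :
    ∃ h : Ω → ℝ, Measurable h ∧ (∀ p, |h p| = 1) ∧
      ∀ x : cube d, f x = ∫ p : Ω, h p * σ (preact x.1 p) ∂μ.variation := by
  obtain ⟨h, hm, habs, hh⟩ := SignedMeasure.exists_density_variation μ
  exact ⟨h, hm, habs, fun x => by rw [(hμ x).2, hh _ (hμ x).1]⟩

theorem BarronEmbeds.of_forall_measure {d : ℕ} {Ω Ω' : Set (Param d)} {σ τ : ℝ → ℝ} (C : ℝ≥0)
    (H : ∀ (f : cube d → ℝ) (ν : Measure Ω) (h : Ω → ℝ), IsFiniteMeasure ν → Measurable h →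
      (∀ p, |h p| = 1) → (∀ x : cube d, f x = ∫ p : Ω, h p * σ (preact x.1 p) ∂ν) →
      ∫⁻ p : Ω, ENNReal.ofReal (barronWeight σ p.1) ∂ν < ⊤ →
      barronNorm Ω' τ f ≤ C * ∫⁻ p : Ω, ENNReal.ofReal (barronWeight σ p.1) ∂ν) :
    BarronEmbeds Ω σ Ω' τ := by
  have key (f : cube d → ℝ) : barronNorm Ω' τ f ≤ ((C + 1 : ℝ≥0) : ENNReal) * barronNorm Ω σ f := by
    -- The constant is raised by 1 to be nonzero: then it passes through the infimum, and
    -- representations of infinite weight satisfy the bound trivially.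
    have hC : ((C + 1 : ℝ≥0) : ENNReal) ≠ 0 := by positivity
    rw [barronNorm.eq_def Ω]
    simp only [ENNReal.mul_iInf_of_ne hC ENNReal.coe_ne_top]
    refine le_iInf₂ fun μ hμ => ?_
    rcases eq_or_ne (∫⁻ p : Ω, ENNReal.ofReal (barronWeight σ p.1) ∂μ.variation) ⊤ with ht | ht
    · rw [ht, ENNReal.mul_top hC]; exact le_top
    obtain ⟨h, hm, habs, hf⟩ := exists_density_of_represents hμ
    have : IsFiniteMeasure μ.variation := by
      rw [← SignedMeasure.totalVariation_eq_variation, SignedMeasure.totalVariation]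
      infer_instance
    refine (H f μ.variation h this hm habs hf ht.lt_top).trans ?_
    gcongr
    simp
  exact ⟨fun f hf => (key f).trans_lt (ENNReal.mul_lt_top ENNReal.coe_lt_top hf),
    C + 1, fun f _ => key f⟩

theorem BarronEmbeds.trans {d : ℕ} {Ω₁ Ω₂ Ω₃ : Set (Param d)} {σ₁ σ₂ σ₃ : ℝ → ℝ}
    (h₁ : BarronEmbeds Ω₁ σ₁ Ω₂ σ₂) (h₂ : BarronEmbeds Ω₂ σ₂ Ω₃ σ₃) :
    BarronEmbeds Ω₁ σ₁ Ω₃ σ₃ := by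
  obtain ⟨i₁, C₁, hC₁⟩ := h₁
  obtain ⟨i₂, C₂, hC₂⟩ := h₂
  refine ⟨i₁.trans i₂, C₂ * C₁, fun f hf => (hC₂ f (i₁ hf)).trans ?_⟩
  rw [ENNReal.coe_mul, mul_assoc]
  gcongr
  exact hC₁ f hf

/-! ### Rescaling and shifting rectified power units -/

theorem exists_pos_forall_paramNorm_le_mem {d : ℕ} {Ω : Set (Param d)} (hΩ : Ω ∈ 𝓝 0) :
    ∃ ε > 0, ∀ p : Param d, paramNorm p ≤ ε → p ∈ Ω := by
  obtain ⟨ε, hε, h⟩ := Metric.nhds_basis_closedBall.mem_iff.1 hΩ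
  exact ⟨ε, hε, fun p hp => h (by simpa using (norm_le_paramNorm p).trans hp)⟩

theorem eq_zero_of_paramNorm_eq_zero {d : ℕ} {p : Param d} (h : paramNorm p = 0) : p = 0 :=
  norm_le_zero_iff.1 ((norm_le_paramNorm p).trans h.le)

theorem integrable_repu_preact {d : ℕ} {A : Type*} [MeasurableSpace A] {ν : Measure A}
    {h : A → ℝ} (hm : Measurable h) {T : A → Param d} (hT : Measurable T) {s : ℕ}
    (hfin : ∫⁻ a, ‖h a‖ₑ * ENNReal.ofReal (paramNorm (T a) ^ s) ∂ν < ⊤) (x : cube d) :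
    Integrable (fun a => h a * repu s (preact x.1 (T a))) ν := by
  have hc : Continuous fun p : Param d => repu s (preact x.1 p) :=
    (continuous_repu s).comp (continuous_preact.comp (continuous_const.prodMk continuous_id))
  refine ⟨(hm.mul (hc.measurable.comp hT)).aestronglyMeasurable, ?_⟩
  rw [hasFiniteIntegral_iff_enorm]
  refine lt_of_le_of_lt (lintegral_mono fun a => ?_) hfin
  rw [enorm_mul, Real.enorm_eq_ofReal_abs (repu _ _)]
  gcongr
  exact abs_repu_preact_le s x _

/-- Homogeneity of the rectified power unit allows to move the parameters of a superposition of
neurons to a small sphere around the origin. -/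
theorem barronNorm_repu_le_lintegral {d : ℕ} {A : Type*} [MeasurableSpace A] {ν : Measure A}
    {h : A → ℝ} (hm : Measurable h) {T : A → Param d} (hT : Measurable T) {s : ℕ} (hs : 1 ≤ s)
    {Ω : Set (Param d)} (hΩ : Ω ∈ 𝓝 0) {f : cube d → ℝ}
    (hfin : ∫⁻ a, ‖h a‖ₑ * ENNReal.ofReal (paramNorm (T a) ^ s) ∂ν < ⊤)
    (hf : ∀ x : cube d, f x = ∫ a, h a * repu s (preact x.1 (T a)) ∂ν) :
    barronNorm Ω (repu s) f ≤ ∫⁻ a, ‖h a‖ₑ * ENNReal.ofReal (paramNorm (T a) ^ s) ∂ν := by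
  obtain ⟨ε, hε, hεΩ⟩ := exists_pos_forall_paramNorm_le_mem hΩ
  have hR : Measurable fun a => paramNorm (T a) := continuous_paramNorm.measurable.comp hT
  -- The density absorbs the factor (R/ε)^s that the unit loses when its parameter moves to norm ε.
  -- For R = 0 both new quantities vanish, and so does the original neuron, because s ≥ 1.
  set h' : A → ℝ := fun a => h a * (paramNorm (T a) / ε) ^ s with hh'
  set T' : A → Param d := fun a => (ε / paramNorm (T a)) • T a with hT'
  have hm' : Measurable h' := hm.mul ((hR.div_const ε).pow_const s)
  have hTm' : Measurable T' := (measurable_const.div hR).smul hT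
  have hnorm (a : A) : paramNorm (T' a) ≤ ε := by
    rw [hT', paramNorm_smul, abs_of_nonneg (div_nonneg hε.le (paramNorm_nonneg _))]
    rcases eq_or_ne (paramNorm (T a)) 0 with h0 | h0
    · rw [h0]; simpa using hε.le
    · rw [div_mul_cancel₀ _ h0]
  have hpt (a : A) (x : cube d) :
      h' a * repu s (preact x.1 (T' a)) = h a * repu s (preact x.1 (T a)) := by
    rcases (paramNorm_nonneg (T a)).eq_or_lt with h0 | h0
    · simp only [hT', hh']
      rw [← h0, eq_zero_of_paramNorm_eq_zero h0.symm]
      simp [preact, repu, Nat.one_le_iff_ne_zero.1 hs]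
    · simp only [hT', hh']
      rw [preact_smul, repu_mul _ (by positivity), mul_assoc, ← mul_assoc (_ ^ s), ← mul_pow,
        div_mul_div_cancel₀ hε.ne', div_self h0.ne', one_pow, one_mul]
  have hle (a : A) : ‖h' a‖ₑ * ENNReal.ofReal (paramNorm (T' a) ^ s) ≤
      ‖h a‖ₑ * ENNReal.ofReal (paramNorm (T a) ^ s) := by
    rw [hh', enorm_mul, mul_assoc]
    gcongr
    rw [Real.enorm_of_nonneg (pow_nonneg (div_nonneg (paramNorm_nonneg _) hε.le) _),
      ← ENNReal.ofReal_mul (pow_nonneg (div_nonneg (paramNorm_nonneg _) hε.le) _), ← mul_pow]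
    apply ENNReal.ofReal_le_ofReal
    have := paramNorm_nonneg (T a)
    refine pow_le_pow_left₀ (mul_nonneg (by positivity) (paramNorm_nonneg _)) ?_ _
    calc paramNorm (T a) / ε * paramNorm (T' a) ≤ paramNorm (T a) / ε * ε := by
          gcongr; exact hnorm a
      _ = _ := by field_simp
  -- The original density need not be integrable. The rescaled one is, since its modulus is ε^(-s)
  -- times the finite weight.
  have hint : Integrable h' ν := by
    refine ⟨hm'.aestronglyMeasurable, ?_⟩
    rw [hasFiniteIntegral_iff_enorm]
    have e (a : A) : ‖h' a‖ₑ =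
        ENNReal.ofReal ((1 / ε) ^ s) * (‖h a‖ₑ * ENNReal.ofReal (paramNorm (T a) ^ s)) := by
      have := paramNorm_nonneg (T a)
      simp only [hh']
      rw [enorm_mul, Real.enorm_of_nonneg (r := (paramNorm (T a) / ε) ^ s) (by positivity),
        mul_left_comm, ← ENNReal.ofReal_mul (by positivity), ← mul_pow, one_div_mul_eq_div]
    simp_rw [e]
    rw [lintegral_const_mul' _ _ ENNReal.ofReal_ne_top]
    exact ENNReal.mul_lt_top ENNReal.ofReal_lt_top hfin
  refine (barronNorm_le_lintegral ν hm' hint hTm' (fun a => hεΩ _ (hnorm a)) (continuous_repu s)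
    (fun x => ?_) (fun x => ?_)).trans ?_
  · simp_rw [hpt]; exact integrable_repu_preact hm hT hfin x
  · simp_rw [hpt]; exact hf x
  · simp_rw [barronWeight_repu hs]
    exact lintegral_mono hle

theorem paramNorm_affine_le {d : ℕ} {e : ℝ} (he : |e| ≤ 1) (c : ℝ) (p : Param d) :
    paramNorm (d := d) (e • p.1, e * p.2 + c) ≤ paramNorm p + |c| := by
  have h1 : |e * p.2 + c| ≤ |p.2| + |c| := by
    refine (abs_add_le _ _).trans (add_le_add_left ?_ _)
    rw [abs_mul]
    exact mul_le_of_le_one_left (abs_nonneg _) he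
  have h2 : |e| * l1norm p.1 ≤ l1norm p.1 := mul_le_of_le_one_left (l1norm_nonneg _) he
  simp only [paramNorm, l1norm_smul]
  linarith

/-- Superposition of the neurons `repu s (e ⟨x, w⟩ + e b - t)` over shifts `t` in `(0, ‖(w, b)‖]`. -/
theorem barronNorm_repu_setIntegral_le {d : ℕ} {A : Type*} [MeasurableSpace A] {ν : Measure A}
    [SFinite ν] {h : A → ℝ} (hm : Measurable h) {P : A → Param d} (hP : Measurable P) {s : ℕ}
    (hs : 1 ≤ s) {Ω : Set (Param d)} (hΩ : Ω ∈ 𝓝 0) {e : ℝ} (he : |e| ≤ 1) {G : ℝ → ℝ}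
    (hG : Measurable G) {B : ℝ → ENNReal}
    (hB : ∀ r, 0 ≤ r → ∫⁻ t in Set.Ioc 0 r, ‖G t‖ₑ ≤ B r)
    (hfin : ∫⁻ a, ‖h a‖ₑ * (ENNReal.ofReal ((2 * paramNorm (P a)) ^ s) * B (paramNorm (P a))) ∂ν < ⊤)
    {f : cube d → ℝ}
    (hf : ∀ x : cube d, f x = ∫ a, h a *
      (∫ t in Set.Ioc 0 (paramNorm (P a)), repu s (e * preact x.1 (P a) - t) * G t) ∂ν) :
    (∀ x : cube d, Integrable (fun a => h a *
      ∫ t in Set.Ioc 0 (paramNorm (P a)), repu s (e * preact x.1 (P a) - t) * G t) ν) ∧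
    barronNorm Ω (repu s) f ≤
      ∫⁻ a, ‖h a‖ₑ * (ENNReal.ofReal ((2 * paramNorm (P a)) ^ s) * B (paramNorm (P a))) ∂ν := by
  have hR : Measurable fun a => paramNorm (P a) := continuous_paramNorm.measurable.comp hP
  -- The range of the shift depends on the parameter, so it enters the density as an indicator on
  -- the product. On its support t ≤ R and |e| ≤ 1, so the shifted parameter has norm at most 2R.
  set h' : A × ℝ → ℝ := fun q => h q.1 * (Set.Ioc 0 (paramNorm (P q.1))).indicator G q.2 with hh'
  set T : A × ℝ → Param d := fun q => (e • (P q.1).1, e * (P q.1).2 + -q.2) with hT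
  have hTm : Measurable T := by fun_prop
  have hm' : Measurable h' := by
    refine (hm.comp measurable_fst).mul ?_
    have hS : MeasurableSet {q : A × ℝ | q.2 ∈ Set.Ioc 0 (paramNorm (P q.1))} :=
      (measurableSet_lt measurable_const measurable_snd).inter
        (measurableSet_le measurable_snd (hR.comp measurable_fst))
    have : (fun q : A × ℝ => (Set.Ioc 0 (paramNorm (P q.1))).indicator G q.2) =
        {q : A × ℝ | q.2 ∈ Set.Ioc 0 (paramNorm (P q.1))}.indicator (fun q => G q.2) := by
      ext q; simp [Set.indicator]
    rw [this]
    exact (hG.comp measurable_snd).indicator hS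
  have hle : ∫⁻ q, ‖h' q‖ₑ * ENNReal.ofReal (paramNorm (T q) ^ s) ∂(ν.prod volume) ≤
      ∫⁻ a, ‖h a‖ₑ * (ENNReal.ofReal ((2 * paramNorm (P a)) ^ s) * B (paramNorm (P a))) ∂ν := by
    have hTR : Measurable fun q => paramNorm (T q) := continuous_paramNorm.measurable.comp hTm
    have hTs : Measurable fun q => ENNReal.ofReal (paramNorm (T q) ^ s) :=
      (hTR.pow_const s).ennreal_ofReal
    rw [lintegral_prod (fun q => ‖h' q‖ₑ * ENNReal.ofReal (paramNorm (T q) ^ s))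
      (hm'.enorm.mul hTs).aemeasurable]
    refine lintegral_mono fun a => ?_
    have : ∀ t, ‖h' (a, t)‖ₑ * ENNReal.ofReal (paramNorm (T (a, t)) ^ s) ≤
        ‖h a‖ₑ * (ENNReal.ofReal ((2 * paramNorm (P a)) ^ s) *
          (Set.Ioc 0 (paramNorm (P a))).indicator (fun t => ‖G t‖ₑ) t) := by
      intro t
      simp only [hh', hT]
      by_cases ht : t ∈ Set.Ioc 0 (paramNorm (P a))
      · rw [Set.indicator_of_mem ht, Set.indicator_of_mem ht, enorm_mul, mul_assoc,
          mul_comm ‖G t‖ₑ]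
        gcongr
        · exact paramNorm_nonneg _
        · refine (paramNorm_affine_le he _ _).trans ?_
          rw [abs_neg, abs_of_pos ht.1]
          linarith [ht.2]
      · simp [ht]
    refine (lintegral_mono this).trans ?_
    rw [lintegral_const_mul' _ _ enorm_ne_top, lintegral_const_mul' _ _ ENNReal.ofReal_ne_top,
      lintegral_indicator measurableSet_Ioc]
    gcongr
    exact hB _ (paramNorm_nonneg _)
  have hint := integrable_repu_preact hm' hTm (hle.trans_lt hfin)
  have hinner (x : cube d) (a : A) : ∫ t, h' (a, t) * repu s (preact x.1 (T (a, t))) =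
      h a * ∫ t in Set.Ioc 0 (paramNorm (P a)), repu s (e * preact x.1 (P a) - t) * G t := by
    simp only [hh', hT, preact_affine]
    rw [← integral_indicator measurableSet_Ioc, ← integral_const_mul]
    refine integral_congr_ae (.of_forall fun t => ?_)
    by_cases ht : t ∈ Set.Ioc 0 (paramNorm (P a))
    · simp only [Set.indicator_of_mem ht, sub_eq_add_neg]; ring
    · simp [ht]
  refine ⟨fun x => ?_,
    (barronNorm_repu_le_lintegral hm' hTm hs hΩ (hle.trans_lt hfin) fun x => ?_).trans hle⟩
  · simpa only [hinner] using (hint x).integral_prod_left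
  · rw [hf x, integral_prod _ (hint x)]
    exact integral_congr_ae (.of_forall fun a => (hinner x a).symm)

/-- The rectifier vanishes for t > z; at s = 0 this would fail, as 0^0 = 1. The upper limit can thus
be the norm of the parameter, which does not depend on the input x. -/
theorem setIntegral_repu_sub {s : ℕ} (hs : 1 ≤ s) {z r : ℝ} (hz : z ≤ r) (G : ℝ → ℝ) :
    ∫ t in Set.Ioc 0 r, repu s (z - t) * G t = ∫ t in Set.Ioc 0 z, (z - t) ^ s * G t := by
  rw [← integral_indicator measurableSet_Ioc, ← integral_indicator measurableSet_Ioc]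
  congr 1
  ext t
  by_cases h1 : t ∈ Set.Ioc 0 z
  · rw [Set.indicator_of_mem h1,
      Set.indicator_of_mem (s := Set.Ioc 0 r) ⟨h1.1, h1.2.trans hz⟩, repu,
      max_eq_right (sub_nonneg.2 h1.2)]
  · rw [Set.indicator_of_notMem h1]
    by_cases h2 : t ∈ Set.Ioc 0 r
    · have : z < t := by
        by_contra! h; exact h1 ⟨h2.1, h⟩
      rw [Set.indicator_of_mem h2, repu, max_eq_left (by linarith), zero_pow (by omega), zero_mul]
    · rw [Set.indicator_of_notMem h2]

theorem repu_succ_eq_setIntegral {s : ℕ} (hs : 1 ≤ s) {z r : ℝ} (hz : z ≤ r) :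
    repu (s + 1) z = ∫ t in Set.Ioc 0 r, repu s (z - t) * (s + 1 : ℝ) := by
  rw [setIntegral_repu_sub hs hz]
  rcases le_total z 0 with h0 | h0
  · rw [Set.Ioc_eq_empty (by simpa using h0), repu, max_eq_left h0]; simp
  · rw [← intervalIntegral.integral_of_le h0, intervalIntegral.integral_mul_const,
      intervalIntegral.integral_comp_sub_left (fun t => t ^ s) z, integral_pow, repu,
      max_eq_right h0]
    simp
    field_simp

/-! ### Embeddings between rectified power units -/

theorem barronEmbeds_repu_self {d s : ℕ} (hs : 1 ≤ s) (Ω : Set (Param d)) {Ω' : Set (Param d)}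
    (hΩ' : Ω' ∈ 𝓝 0) : BarronEmbeds Ω (repu s) Ω' (repu s) := by
  refine .of_forall_measure 1 fun f ν h _ hm habs hf hfin => ?_
  have e (p : Ω) : ‖h p‖ₑ = 1 := by rw [Real.enorm_eq_ofReal_abs, habs]; simp
  simp only [barronWeight_repu hs] at hfin ⊢
  have := barronNorm_repu_le_lintegral (ν := ν) hm measurable_subtype_coe hs hΩ' (f := f)
    (by simpa [e, paramNorm] using hfin) hf
  simpa [e, paramNorm] using this

/-- The shifts fill an interval of length R with constant density s + 1, so the cost is (2R)^s ·
(s+1)R, a multiple of the source weight R^(s+1). -/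
theorem barronEmbeds_repu_succ {d s : ℕ} (hs : 1 ≤ s) (Ω : Set (Param d)) {Ω' : Set (Param d)}
    (hΩ' : Ω' ∈ 𝓝 0) : BarronEmbeds Ω (repu (s + 1)) Ω' (repu s) := by
  refine .of_forall_measure (2 ^ s * (s + 1)) fun f ν h _ hm habs hf hfin => ?_
  have e (p : Ω) : ‖h p‖ₑ = 1 := by rw [Real.enorm_eq_ofReal_abs, habs]; simp
  simp only [barronWeight_repu (hs.trans s.le_succ)] at hfin ⊢
  have hc : ((2 ^ s * (s + 1) : ℝ≥0) : ENNReal) = ENNReal.ofReal (2 ^ s * (s + 1)) := by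
    rw [ENNReal.ofReal, Real.toNNReal_mul (by positivity)]
    simp [Real.toNNReal_add, Real.toNNReal_pow]
  have key : ∫⁻ p : Ω, ‖h p‖ₑ * (ENNReal.ofReal ((2 * paramNorm p.1) ^ s) *
        ENNReal.ofReal ((s + 1) * paramNorm p.1)) ∂ν =
      ((2 ^ s * (s + 1) : ℝ≥0) : ENNReal) *
        ∫⁻ p : Ω, ENNReal.ofReal ((l1norm p.1.1 + |p.1.2|) ^ (s + 1)) ∂ν := by
    rw [← lintegral_const_mul' _ _ ENNReal.coe_ne_top]
    refine lintegral_congr fun p => ?_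
    have := paramNorm_nonneg p.1
    rw [e, one_mul, ← ENNReal.ofReal_mul (by positivity), hc,
      ← ENNReal.ofReal_mul (by positivity)]
    congr 1
    rw [← paramNorm]; ring
  rw [← key]
  refine (barronNorm_repu_setIntegral_le hm measurable_subtype_coe hs hΩ' (e := 1) (by simp)
    (G := fun _ => s + 1) measurable_const (B := fun r => ENNReal.ofReal ((s + 1) * r))
    (fun r hr => ?_) ?_ fun x => ?_).2
  · rw [lintegral_const, Measure.restrict_apply_univ, Real.volume_Ioc,
      Real.enorm_of_nonneg (by positivity), ← ENNReal.ofReal_mul (by positivity), sub_zero]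
  · rw [key]
    exact ENNReal.mul_lt_top ENNReal.coe_lt_top hfin
  · rw [hf x]
    refine integral_congr_ae (.of_forall fun p => ?_)
    beta_reduce
    rw [one_mul, ← repu_succ_eq_setIntegral hs ((le_abs_self _).trans (abs_preact_le x p.1))]

theorem barronEmbeds_repu_of_le {d s t : ℕ} (ht : 1 ≤ t) (hts : t ≤ s) (Ω : Set (Param d))
    {Ω' : Set (Param d)} (hΩ' : Ω' ∈ 𝓝 0) : BarronEmbeds Ω (repu s) Ω' (repu t) := by
  induction s, hts using Nat.le_induction generalizing Ω with
  | base => exact barronEmbeds_repu_self ht Ω hΩ'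
  | succ s hts ih =>
    exact (barronEmbeds_repu_succ (ht.trans hts) Ω Filter.univ_mem).trans (ih Set.univ)

/-! ### Polynomials and Taylor remainders as superpositions of rectified power units -/

/-- Expanding (z + j)^s by the binomial theorem turns the comparison of coefficients into a
Vandermonde system with the distinct nodes 0, …, s. -/
theorem exists_sum_pow_add_eq (s : ℕ) (c : ℕ → ℝ) : ∃ L : Fin (s + 1) → ℝ, ∀ z : ℝ,
    ∑ k ∈ Finset.range (s + 1), c k * z ^ k = ∑ j : Fin (s + 1), L j * (z + (j : ℕ)) ^ s := by
  set v : Fin (s + 1) → ℝ := fun j => ((j : ℕ) : ℝ)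
  have hv : IsUnit (Matrix.vandermonde v).det := by
    rw [isUnit_iff_ne_zero, Matrix.det_vandermonde_ne_zero_iff]
    intro i j hij
    exact Fin.ext (Nat.cast_injective hij)
  -- τ m is the moment ∑ L j · j^m prescribed by the coefficient of z^(s-m).
  set τ : Fin (s + 1) → ℝ := fun m => c (s - m) / s.choose (s - m)
  have hL : Matrix.vecMul (Matrix.vecMul τ (Matrix.vandermonde v)⁻¹) (Matrix.vandermonde v) = τ := by
    rw [Matrix.vecMul_vecMul, Matrix.nonsing_inv_mul _ hv, Matrix.vecMul_one]
  refine ⟨Matrix.vecMul τ (Matrix.vandermonde v)⁻¹, fun z => ?_⟩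
  set L := Matrix.vecMul τ (Matrix.vandermonde v)⁻¹
  have hL' (m : ℕ) (hm : m < s + 1) : ∑ j, L j * ((j : ℕ) : ℝ) ^ m = c (s - m) / s.choose (s - m) := by
    have := congrFun hL ⟨m, hm⟩
    simpa [Matrix.vecMul, dotProduct, Matrix.vandermonde_apply, v, τ] using this
  simp_rw [add_pow, Finset.mul_sum]
  rw [Finset.sum_comm]
  refine Finset.sum_congr rfl fun k hk => ?_
  have hk' : k ≤ s := Nat.lt_succ_iff.1 (Finset.mem_range.1 hk)
  have h1 : ∑ j : Fin (s + 1), L j * (z ^ k * ((j : ℕ) : ℝ) ^ (s - k) * (s.choose k : ℝ)) =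
      z ^ k * s.choose k * ∑ j, L j * ((j : ℕ) : ℝ) ^ (s - k) := by
    rw [Finset.mul_sum]
    exact Finset.sum_congr rfl fun j _ => by ring
  rw [h1, hL' (s - k) (by omega), Nat.sub_sub_self hk']
  have : (s.choose k : ℝ) ≠ 0 := by exact_mod_cast (Nat.choose_pos hk').ne'
  field_simp

theorem pow_eq_repu_add_repu_neg {s : ℕ} (hs : 1 ≤ s) (y : ℝ) :
    y ^ s = repu s y + (-1) ^ s * repu s (-y) := by
  have h0 : (0 : ℝ) ^ s = 0 := zero_pow (by omega)
  rcases le_total 0 y with h | h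
  · rw [repu, repu, max_eq_right h, max_eq_left (by linarith), h0]; ring
  · rw [repu, repu, max_eq_left h, max_eq_right (by linarith), h0, ← mul_pow]; ring

theorem exists_sum_repu_eq {s : ℕ} (hs : 1 ≤ s) (c : ℕ → ℝ) :
    ∃ L e b : Fin (s + 1) ⊕ Fin (s + 1) → ℝ, (∀ i, |e i| ≤ 1) ∧ ∀ z : ℝ,
      ∑ k ∈ Finset.range (s + 1), c k * z ^ k = ∑ i, L i * repu s (e i * z + b i) := by
  obtain ⟨L, hL⟩ := exists_sum_pow_add_eq s c
  refine ⟨Sum.elim L fun j => (-1) ^ s * L j, Sum.elim (fun _ => 1) fun _ => -1,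
    Sum.elim (fun j => (j : ℕ)) fun j => -(j : ℕ), by rintro (i | i) <;> simp, fun z => ?_⟩
  rw [hL, Fintype.sum_sum_type, ← Finset.sum_add_distrib]
  refine Finset.sum_congr rfl fun j _ => ?_
  rw [pow_eq_repu_add_repu_neg hs]
  simp only [Sum.elim_inl, Sum.elim_inr]
  ring_nf

/-- Taylor's formula at `0` with the remainder in integral form, for a function whose derivative
of order `s` is a primitive of `g`. -/
theorem eq_taylor_add_integral {s : ℕ} {ψ g : ℝ → ℝ} (hψ : ContDiff ℝ s ψ)
    (hg : LocallyIntegrable g volume)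
    (hprim : ∀ z, iteratedDeriv s ψ z = iteratedDeriv s ψ 0 + ∫ t in (0 : ℝ)..z, g t) (z : ℝ) :
    ψ z = ∑ k ∈ Finset.range (s + 1), iteratedDeriv k ψ 0 / k.factorial * z ^ k +
      ∫ t in (0 : ℝ)..z, (z - t) ^ s * (g t / s.factorial) := by
  rcases eq_or_ne z 0 with rfl | hz
  · simp [Finset.sum_range_succ']
  have hu : UniqueDiffOn ℝ (Set.uIcc 0 z) := uniqueDiffOn_uIcc hz.symm
  have hw (k : ℕ) (hk : k ≤ s) (t : ℝ) (ht : t ∈ Set.uIcc 0 z) :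
      iteratedDerivWithin k ψ (Set.uIcc 0 z) t = iteratedDeriv k ψ t :=
    iteratedDerivWithin_eq_iteratedDeriv hu (hψ.of_le (by exact_mod_cast hk)).contDiffAt ht
  have hfun : iteratedDeriv s ψ = (fun _ => iteratedDeriv s ψ 0) + fun z => ∫ t in (0 : ℝ)..z, g t :=
    funext hprim
  have hac : AbsolutelyContinuousOnInterval (iteratedDeriv s ψ) 0 z := by
    rw [hfun]
    refine AbsolutelyContinuousOnInterval.add
      (ContDiffOn.absolutelyContinuousOnInterval contDiffOn_const) ?_
    exact IntervalIntegrable.absolutelyContinuousOnInterval_intervalIntegral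
      (hg.integrableOn_isCompact isCompact_uIcc).intervalIntegrable (by simp)
  have hac' : AbsolutelyContinuousOnInterval (iteratedDerivWithin s ψ (Set.uIcc 0 z)) 0 z := by
    refine Filter.Tendsto.congr' ?_ hac
    -- Absolute continuity only sees families of intervals with endpoints in the interval, where the
    -- two derivatives coincide.
    filter_upwards [Filter.mem_inf_of_right (Filter.mem_principal_self _)] with E hE
    refine Finset.sum_congr rfl fun i hi => ?_
    rw [hw s le_rfl _ (hE.1 i hi).1, hw s le_rfl _ (hE.1 i hi).2]
  have := taylor_integral_remainder_of_absolutelyContinuous hψ.contDiffOn hac'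
  rw [taylor_within_apply, sub_eq_iff_eq_add'] at this
  rw [this]
  congr 1
  · refine Finset.sum_congr rfl fun k hk => ?_
    rw [hw k (Nat.lt_succ_iff.1 (Finset.mem_range.1 hk)) 0 (by simp)]
    simp only [sub_zero, smul_eq_mul]
    ring
  · refine intervalIntegral.integral_congr_ae ?_
    -- The endpoints are discarded so that the interval is a neighbourhood of t and the one-sided
    -- derivative is the ordinary one, equal to g almost everywhere by Lebesgue differentiation.
    have hne : ∀ᵐ t : ℝ, t ≠ z := by simp [ae_iff, measure_singleton]
    have hne0 : ∀ᵐ t : ℝ, t ≠ 0 := by simp [ae_iff, measure_singleton]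
    filter_upwards [LocallyIntegrable.ae_hasDerivAt_integral hg, hne, hne0] with t ht htz ht0 hmem
    have hI : Set.uIcc 0 z ∈ 𝓝 t := by
      rcases le_total 0 z with h | h
      · rw [Set.uIoc_of_le h] at hmem
        rw [Set.uIcc_of_le h]
        exact Icc_mem_nhds hmem.1 (lt_of_le_of_ne hmem.2 htz)
      · rw [Set.uIoc_of_ge h] at hmem
        rw [Set.uIcc_of_ge h]
        exact Icc_mem_nhds hmem.1 (lt_of_le_of_ne hmem.2 ht0)
    have hd : iteratedDerivWithin (s + 1) ψ (Set.uIcc 0 z) t = g t := by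
      rw [iteratedDerivWithin_succ, derivWithin_of_mem_nhds hI]
      have : iteratedDerivWithin s ψ (Set.uIcc 0 z) =ᶠ[𝓝 t] iteratedDeriv s ψ := by
        filter_upwards [hI] with y hy using hw s le_rfl y hy
      rw [this.deriv_eq, hfun]
      exact ((ht 0).const_add (iteratedDeriv s ψ 0)).deriv
    rw [hd]
    ring

/-- At most one of the two shift integrals is nonzero, according to the sign of z. For z ≤ 0 the
substitution t ↦ -t gives (-1)^s from the power and one more sign from the orientation. -/
theorem eq_sum_repu_add_setIntegral {s : ℕ} (hs : 1 ≤ s) {ψ g : ℝ → ℝ} (hψ : ContDiff ℝ s ψ)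
    (hg : LocallyIntegrable g volume)
    (hprim : ∀ z, iteratedDeriv s ψ z = iteratedDeriv s ψ 0 + ∫ t in (0 : ℝ)..z, g t)
    {z r : ℝ} (hz : |z| ≤ r) :
    ψ z = ∑ k ∈ Finset.range (s + 1), iteratedDeriv k ψ 0 / k.factorial * z ^ k +
      ((∫ t in Set.Ioc 0 r, repu s (1 * z - t) * (g t / s.factorial)) +
      ∫ t in Set.Ioc 0 r, repu s (-1 * z - t) * ((-1) ^ (s + 1) * g (-t) / s.factorial)) := by
  rw [eq_taylor_add_integral hψ hg hprim z, one_mul, neg_one_mul,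
    setIntegral_repu_sub hs ((le_abs_self z).trans hz),
    setIntegral_repu_sub hs ((neg_le_abs z).trans hz)]
  congr 1
  rcases le_total 0 z with h | h
  · rw [(Set.Ioc_eq_empty_of_le (by linarith) : Set.Ioc 0 (-z) = ∅),
      intervalIntegral.integral_of_le h]
    simp
  · rw [(Set.Ioc_eq_empty_of_le h : Set.Ioc 0 z = ∅),
      ← intervalIntegral.integral_of_le (by linarith)]
    simp only [Measure.restrict_empty, integral_zero_measure, zero_add]
    have := intervalIntegral.integral_comp_neg (a := 0) (b := -z)
      (fun t => (z - t) ^ s * (g t / s.factorial))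
    rw [neg_neg, neg_zero] at this
    rw [intervalIntegral.integral_symm, ← this, ← intervalIntegral.integral_neg]
    refine intervalIntegral.integral_congr fun t _ => ?_
    have : (-z - t) ^ s = (-1) ^ s * (z - -t) ^ s := by rw [← mul_pow]; ring
    have h1 : ((-1 : ℝ) ^ s) * (-1) ^ s = 1 := by rw [← mul_pow]; simp
    simp only [this, pow_succ]
    linear_combination ((z - -t) ^ s * (g (-t) / s.factorial)) * h1

/-- A superposition of neurons with an activation whose derivative of order `s` is a primitive of a
function of controlled growth belongs to the Barron space of the rectified power unit. -/
theorem exists_barronNorm_repu_le_of_primitive {d s m : ℕ} (hs : 1 ≤ s) {ψ g : ℝ → ℝ}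
    (hψ : ContDiff ℝ s ψ) (hgm : Measurable g) (hg : LocallyIntegrable g volume)
    (hprim : ∀ z, iteratedDeriv s ψ z = iteratedDeriv s ψ 0 + ∫ t in (0 : ℝ)..z, g t) (B : ℝ≥0)
    (hB : ∀ r : ℝ, 0 ≤ r → ∫⁻ t in Set.Icc (-r) r, ‖g t‖ₑ ≤ B * ENNReal.ofReal ((1 + r) ^ m)) :
    ∃ C : ℝ≥0, ∀ (Ω : Set (Param d)), Ω ∈ 𝓝 0 → ∀ (A : Type) [MeasurableSpace A] (ν : Measure A)
      [SFinite ν] (h : A → ℝ) (P : A → Param d) (f : cube d → ℝ), Measurable h → Measurable P →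
      ∫⁻ a, ‖h a‖ₑ * ENNReal.ofReal ((1 + paramNorm (P a)) ^ (s + m)) ∂ν < ⊤ →
      (∀ x : cube d, f x = ∫ a, h a * ψ (preact x.1 (P a)) ∂ν) →
      barronNorm Ω (repu s) f ≤
        C * ∫⁻ a, ‖h a‖ₑ * ENNReal.ofReal ((1 + paramNorm (P a)) ^ (s + m)) ∂ν := by
  obtain ⟨L, e, b, he, hL⟩ := exists_sum_repu_eq hs fun k => iteratedDeriv k ψ 0 / k.factorial
  set G₁ : ℝ → ℝ := fun t => g t / s.factorial with hG₁
  set G₂ : ℝ → ℝ := fun t => (-1) ^ (s + 1) * g (-t) / s.factorial with hG₂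
  have hG₁m : Measurable G₁ := hgm.div_const _
  have hG₂m : Measurable G₂ := ((hgm.comp measurable_neg).const_mul _).div_const _
  have hfac : (1 : ℝ) ≤ s.factorial := by exact_mod_cast Nat.one_le_iff_ne_zero.2 s.factorial_ne_zero
  have hG₁le (t : ℝ) : ‖G₁ t‖ₑ ≤ ‖g t‖ₑ := by
    rw [enorm_le_iff_norm_le, norm_div, Real.norm_natCast]
    exact div_le_self (norm_nonneg _) hfac
  have hG₂le (t : ℝ) : ‖G₂ t‖ₑ ≤ ‖g (-t)‖ₑ := by
    rw [enorm_le_iff_norm_le, norm_div, Real.norm_natCast, norm_mul, norm_pow, norm_neg, norm_one,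
      one_pow, one_mul]
    exact div_le_self (norm_nonneg _) hfac
  have hB₁ (r : ℝ) (hr : 0 ≤ r) :
      ∫⁻ t in Set.Ioc 0 r, ‖G₁ t‖ₑ ≤ B * ENNReal.ofReal ((1 + r) ^ m) := by
    refine (lintegral_mono hG₁le).trans (le_trans (lintegral_mono_set fun t ht => ?_) (hB r hr))
    exact ⟨by linarith [ht.1], ht.2⟩
  have hB₂ (r : ℝ) (hr : 0 ≤ r) :
      ∫⁻ t in Set.Ioc 0 r, ‖G₂ t‖ₑ ≤ B * ENNReal.ofReal ((1 + r) ^ m) := by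
    refine (lintegral_mono hG₂le).trans (le_trans ?_ (hB r hr))
    have hsub : Set.Ioc 0 r ⊆ (fun t : ℝ => -t) ⁻¹' Set.Icc (-r) r :=
      fun t ht => ⟨by simpa using ht.2, by linarith [ht.1]⟩
    refine (lintegral_mono_set hsub).trans (le_of_eq ?_)
    exact (Measure.measurePreserving_neg volume).setLIntegral_comp_preimage measurableSet_Icc
      hgm.enorm
  -- The sum pays for the Taylor polynomial, since R + |b| ≤ (1 + |b|)(1 + R). Each of the two
  -- remainders costs 2^s B, since its shifted parameters have norm at most 2R.
  refine ⟨∑ i, ‖L i‖₊ * Real.toNNReal ((1 + |b i|) ^ s) + (2 ^ s * B + 2 ^ s * B),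
    fun Ω hΩ A _ ν _ h P f hm hP hfin hf => ?_⟩
  set M := ∫⁻ a, ‖h a‖ₑ * ENNReal.ofReal ((1 + paramNorm (P a)) ^ (s + m)) ∂ν with hM
  have hpoly (i : Fin (s + 1) ⊕ Fin (s + 1)) :
      ∫⁻ a, ‖h a * L i‖ₑ * ENNReal.ofReal (paramNorm (d := d) (e i • (P a).1, e i * (P a).2 + b i) ^ s) ∂ν ≤
        (‖L i‖₊ * Real.toNNReal ((1 + |b i|) ^ s) : ℝ≥0) * M := by
    rw [hM, ← lintegral_const_mul' _ _ ENNReal.coe_ne_top]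
    refine lintegral_mono fun a => ?_
    have h0 := paramNorm_nonneg (P a)
    have h1 : paramNorm (d := d) (e i • (P a).1, e i * (P a).2 + b i) ^ s ≤
        (1 + |b i|) ^ s * (1 + paramNorm (P a)) ^ (s + m) := by
      calc _ ≤ ((1 + |b i|) * (1 + paramNorm (P a))) ^ s := by
            refine pow_le_pow_left₀ (paramNorm_nonneg _)
              ((paramNorm_affine_le (he i) _ _).trans ?_) _
            nlinarith [abs_nonneg (b i), mul_nonneg (abs_nonneg (b i)) h0]
        _ ≤ _ := by
            rw [mul_pow]
            gcongr
            · linarith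
            · omega
    calc _ ≤ ‖h a * L i‖ₑ * (ENNReal.ofReal ((1 + |b i|) ^ s) *
          ENNReal.ofReal ((1 + paramNorm (P a)) ^ (s + m))) := by
          rw [← ENNReal.ofReal_mul (by positivity)]
          exact mul_le_mul_right (ENNReal.ofReal_le_ofReal h1) _
      _ = _ := by
          rw [enorm_mul, ENNReal.coe_mul, ← ENNReal.ofReal, ← enorm_eq_nnnorm]
          ring
  have hrem : ∫⁻ a, ‖h a‖ₑ * (ENNReal.ofReal ((2 * paramNorm (P a)) ^ s) *
      (B * ENNReal.ofReal ((1 + paramNorm (P a)) ^ m))) ∂ν ≤ (2 ^ s * B : ℝ≥0) * M := by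
    rw [hM, ← lintegral_const_mul' _ _ ENNReal.coe_ne_top]
    refine lintegral_mono fun a => ?_
    have h0 := paramNorm_nonneg (P a)
    have h2 : ((2 ^ s * B : ℝ≥0) : ENNReal) = ENNReal.ofReal (2 ^ s) * B := by
      rw [ENNReal.coe_mul, ENNReal.ofReal_pow (by norm_num)]
      simp
    calc _ = ‖h a‖ₑ * B * (ENNReal.ofReal ((2 * paramNorm (P a)) ^ s) *
          ENNReal.ofReal ((1 + paramNorm (P a)) ^ m)) := by ring
      _ ≤ ‖h a‖ₑ * B * (ENNReal.ofReal (2 ^ s) *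
          ENNReal.ofReal ((1 + paramNorm (P a)) ^ (s + m))) := by
          rw [← ENNReal.ofReal_mul (by positivity), ← ENNReal.ofReal_mul (by positivity)]
          refine mul_le_mul_right (ENNReal.ofReal_le_ofReal ?_) _
          rw [pow_add, ← mul_assoc, mul_pow]
          have : paramNorm (P a) ≤ 1 + paramNorm (P a) := by linarith
          gcongr
      _ = _ := by rw [h2]; ring
  have hMC (C : ℝ≥0) : (C : ENNReal) * M < ⊤ := ENNReal.mul_lt_top ENNReal.coe_lt_top hfin
  have hTm (i : Fin (s + 1) ⊕ Fin (s + 1)) :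
      Measurable fun a => ((e i • (P a).1, e i * (P a).2 + b i) : Param d) := by fun_prop
  set F : Fin (s + 1) ⊕ Fin (s + 1) → cube d → ℝ := fun i x =>
    ∫ a, h a * L i * repu s (preact x.1 (e i • (P a).1, e i * (P a).2 + b i)) ∂ν with hF
  set F₁ : cube d → ℝ := fun x => ∫ a, h a *
    (∫ t in Set.Ioc 0 (paramNorm (P a)), repu s (1 * preact x.1 (P a) - t) * G₁ t) ∂ν with hF₁
  set F₂ : cube d → ℝ := fun x => ∫ a, h a *
    (∫ t in Set.Ioc 0 (paramNorm (P a)), repu s (-1 * preact x.1 (P a) - t) * G₂ t) ∂ν with hF₂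
  obtain ⟨hi₁, hn₁⟩ := barronNorm_repu_setIntegral_le hm hP hs hΩ (e := 1) (by simp) hG₁m hB₁
    (hrem.trans_lt (hMC _)) (f := F₁) fun x => rfl
  obtain ⟨hi₂, hn₂⟩ := barronNorm_repu_setIntegral_le hm hP hs hΩ (e := -1) (by simp) hG₂m hB₂
    (hrem.trans_lt (hMC _)) (f := F₂) fun x => rfl
  have hiF (i : Fin (s + 1) ⊕ Fin (s + 1)) (x : cube d) := integrable_repu_preact
    (hm.mul_const (L i)) (hTm i) ((hpoly i).trans_lt (hMC _)) x
  have hnF (i : Fin (s + 1) ⊕ Fin (s + 1)) := barronNorm_repu_le_lintegral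
    (hm.mul_const (L i)) (hTm i) hs hΩ (f := F i) ((hpoly i).trans_lt (hMC _)) fun x => rfl
  have hdecomp : f = ∑ i, F i + (F₁ + F₂) := by
    ext x
    simp only [Pi.add_apply, Finset.sum_apply, hF, hF₁, hF₂]
    rw [← integral_finsetSum _ fun i _ => hiF i x, ← integral_add (hi₁ x) (hi₂ x),
      ← integral_add (integrable_finsetSum _ fun i _ => hiF i x) ((hi₁ x).fun_add (hi₂ x)), hf x]
    refine integral_congr_ae (.of_forall fun a => ?_)
    beta_reduce
    rw [eq_sum_repu_add_setIntegral hs hψ hg hprim (abs_preact_le x (P a)), hL, mul_add, mul_add,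
      Finset.mul_sum]
    simp only [preact_affine, mul_assoc, hG₁, hG₂]
  rw [hdecomp, ENNReal.coe_add, ENNReal.coe_add, ENNReal.ofNNReal_finsetSum, add_mul, add_mul,
    Finset.sum_mul]
  refine (barronNorm_add_le _ _ _ _).trans (add_le_add ((barronNorm_sum_le _ _ _ _).trans ?_)
    ((barronNorm_add_le _ _ _ _).trans (add_le_add (hn₁.trans hrem) (hn₂.trans hrem))))
  exact Finset.sum_le_sum fun i _ => (hnF i).trans (hpoly i)

/-! ### Weak derivatives and primitives -/

theorem HasCompactSupport.exists_support_subset_Ioc {f : ℝ → ℝ} (hf : HasCompactSupport f) :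
    ∃ R : ℝ, 0 < R ∧ Function.support f ⊆ Set.Ioc (-R) R := by
  obtain ⟨R, hR⟩ := hf.isCompact.isBounded.subset_closedBall 0
  refine ⟨|R| + 1, by positivity, fun x hx => ?_⟩
  have := hR (subset_tsupport f hx)
  rw [mem_closedBall_zero_iff, Real.norm_eq_abs] at this
  have h1 := abs_le.1 this
  have h2 := le_abs_self R
  exact ⟨by linarith [h1.1], by linarith [h1.2]⟩

/-- A test function of integral zero is the derivative of a test function. -/
theorem exists_deriv_eq_of_integral_eq_zero {φ : ℝ → ℝ} (hφ : ContDiff ℝ ∞ φ)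
    (hc : HasCompactSupport φ) (h0 : ∫ x, φ x = 0) :
    ∃ η : ℝ → ℝ, ContDiff ℝ ∞ η ∧ HasCompactSupport η ∧ deriv η = φ := by
  obtain ⟨R, hR, hsupp⟩ := hc.exists_support_subset_Ioc
  set η : ℝ → ℝ := fun x => ∫ t in (-R)..x, φ t with hη
  have hd (x : ℝ) : HasDerivAt η (φ x) x :=
    intervalIntegral.integral_hasDerivAt_right (hφ.continuous.intervalIntegrable _ _)
      (hφ.continuous.stronglyMeasurableAtFilter _ _) hφ.continuous.continuousAt
  have hde : deriv η = φ := funext fun x => (hd x).deriv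
  refine ⟨η, ?_, ?_, hde⟩
  · rw [contDiff_infty_iff_deriv, hde]
    exact ⟨fun x => (hd x).differentiableAt, hφ⟩
  · refine HasCompactSupport.intro (isCompact_Icc : IsCompact (Set.Icc (-R) R)) fun x hx => ?_
    rcases lt_or_ge x (-R) with h | h
    · simp only [hη]
      rw [intervalIntegral.integral_symm, intervalIntegral.integral_of_le h.le,
        setIntegral_eq_zero_of_forall_eq_zero, neg_zero]
      intro t ht
      by_contra hne
      exact absurd (hsupp hne).1 (not_lt.2 ht.2)
    · have hx' : R < x := by
        by_contra! h'; exact hx ⟨h, h'⟩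
      simp only [hη]
      rw [intervalIntegral.integral_eq_integral_of_support_subset, h0]
      exact hsupp.trans (Set.Ioc_subset_Ioc_right hx'.le)

/-- The lemma of du Bois-Reymond for continuous functions. -/
theorem Continuous.eq_of_forall_integral_mul_deriv_eq_zero {u : ℝ → ℝ} (hu : Continuous u)
    (h : ∀ η : ℝ → ℝ, ContDiff ℝ ∞ η → HasCompactSupport η → ∫ x, u x * deriv η x = 0) (x y : ℝ) :
    u x = u y := by
  let b : ContDiffBump (0 : ℝ) := default
  set ρ : ℝ → ℝ := b.normed volume with hρ
  have hρc : ContDiff ℝ ∞ ρ := b.contDiff_normed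
  have hρs : HasCompactSupport ρ := b.hasCompactSupport_normed
  have hρi : ∫ x, ρ x = 1 := b.integral_normed
  set c : ℝ := ∫ x, u x * ρ x with hcdef
  have hae : ∀ᵐ x : ℝ, u x = c := by
    refine ae_eq_of_integral_contDiff_smul_eq hu.locallyIntegrable
      (locallyIntegrable_const c) fun φ hφ hφs => ?_
    have hi {f : ℝ → ℝ} (hf : ContDiff ℝ ∞ f) (hs : HasCompactSupport f) :
        Integrable f := hf.continuous.integrable_of_hasCompactSupport hs
    have hiu {f : ℝ → ℝ} (hf : ContDiff ℝ ∞ f) (hs : HasCompactSupport f) :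
        Integrable fun x => u x * f x :=
      (hu.mul hf.continuous).integrable_of_hasCompactSupport hs.mul_left
    have hcρ : HasCompactSupport fun x => (∫ y, φ y) * ρ x := hρs.mul_left
    -- Subtracting (∫ φ) ρ from φ leaves a test function of mean zero, hence a derivative. Testing u
    -- against it gives ∫ u φ = c ∫ φ.
    obtain ⟨η, hη, hηs, hηd⟩ := exists_deriv_eq_of_integral_eq_zero
      (φ := fun x => φ x - (∫ y, φ y) * ρ x) (hφ.sub (contDiff_const.mul hρc)) (hφs.sub hcρ) (by
        rw [integral_sub (hi hφ hφs) ((hi hρc hρs).const_mul _), integral_const_mul, hρi]; ring)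
    have h0 := h η hη hηs
    simp_rw [hηd, mul_sub, mul_left_comm (u _)] at h0
    rw [integral_sub (hiu hφ hφs) ((hiu hρc hρs).const_mul _), integral_const_mul] at h0
    simp only [smul_eq_mul]
    rw [integral_mul_const, hcdef, ← sub_eq_zero.1 h0]
    simp_rw [mul_comm]
  have := (Continuous.ae_eq_iff_eq volume hu continuous_const).1 hae
  rw [this]

theorem integral_mul_iteratedDeriv_eq {s : ℕ} {ψ : ℝ → ℝ} (hψ : ContDiff ℝ s ψ) {η : ℝ → ℝ}
    (hη : ContDiff ℝ ∞ η) (hs : HasCompactSupport η) :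
    ∫ x, ψ x * iteratedDeriv s η x = (-1) ^ s * ∫ x, iteratedDeriv s ψ x * η x := by
  induction s generalizing η with
  | zero => simp
  | succ k ih =>
    have hη' : ContDiff ℝ ∞ (deriv η) := (contDiff_infty_iff_deriv.1 hη).2
    have h1 : ContDiff ℝ 1 (iteratedDeriv k ψ) := by
      have h2 : ContDiff ℝ (1 + k : ℕ) ψ := by rwa [add_comm]
      simpa [iteratedDeriv_eq_iterate] using ContDiff.iterate_deriv' 1 k h2
    have hcd : Continuous (iteratedDeriv (k + 1) ψ) := hψ.continuous_iteratedDeriv _ le_rfl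
    rw [iteratedDeriv_succ', ih (hψ.of_le (by exact_mod_cast k.le_succ)) hη' hs.deriv,
      integral_mul_deriv_eq_deriv_mul_of_integrable (u' := iteratedDeriv (k + 1) ψ)
        (v := η) (v' := deriv η)]
    · ring
    · intro x _
      rw [iteratedDeriv_succ]
      exact (h1.differentiable one_ne_zero x).hasDerivAt
    · intro x _
      exact ((contDiff_infty_iff_deriv.1 hη).1 x).hasDerivAt
    · exact (h1.continuous.mul hη'.continuous).integrable_of_hasCompactSupport hs.deriv.mul_left
    · exact (hcd.mul hη.continuous).integrable_of_hasCompactSupport hs.mul_left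
    · exact (h1.continuous.mul hη.continuous).integrable_of_hasCompactSupport hs.mul_left

/-- As g is only locally integrable, the primitive is merely absolutely continuous; integration by
parts takes place on an interval containing the support of η. -/
theorem integral_primitive_mul_deriv_eq {g : ℝ → ℝ} (hg : LocallyIntegrable g volume) {η : ℝ → ℝ}
    (hη : ContDiff ℝ ∞ η) (hs : HasCompactSupport η) :
    ∫ x, (∫ t in (0 : ℝ)..x, g t) * deriv η x = -∫ x, g x * η x := by
  obtain ⟨R, hR, hsupp⟩ := hs.exists_support_subset_Ioc
  -- The derivative is controlled only on the closed support, which may contain -R; widening by 1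
  -- places it inside a half-open interval.
  have hsuppd : Function.support (deriv η) ⊆ Set.Ioc (-R - 1) (R + 1) := by
    intro x hx
    have : x ∈ tsupport η := support_deriv_subset hx
    have := (closure_mono hsupp).trans (closure_mono Set.Ioc_subset_Icc_self) this
    rw [isClosed_Icc.closure_eq] at this
    exact ⟨by linarith [this.1], by linarith [this.2]⟩
  have hsupp' : Function.support η ⊆ Set.Ioc (-R - 1) (R + 1) :=
    hsupp.trans (Set.Ioc_subset_Ioc (by linarith) (by linarith))
  have hη1 : η (R + 1) = 0 := by
    by_contra h; linarith [(hsupp h).2]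
  have hη2 : η (-R - 1) = 0 := by
    by_contra h; linarith [(hsupp h).1]
  have hac : AbsolutelyContinuousOnInterval (fun x => ∫ t in (0 : ℝ)..x, g t) (-R - 1) (R + 1) :=
    IntervalIntegrable.absolutelyContinuousOnInterval_intervalIntegral
      (hg.integrableOn_isCompact isCompact_uIcc).intervalIntegrable
      (by rw [Set.uIcc_of_le (by linarith)]; constructor <;> linarith)
  have hac' : AbsolutelyContinuousOnInterval η (-R - 1) (R + 1) :=
    ContDiffOn.absolutelyContinuousOnInterval (hη.of_le (by simp)).contDiffOn
  have key := hac.integral_mul_deriv_eq_deriv_mul hac'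
  rw [hη1, hη2, mul_zero, mul_zero, sub_zero, zero_sub,
    intervalIntegral.integral_eq_integral_of_support_subset
      ((Function.support_mul_subset_right _ _).trans hsuppd),
    intervalIntegral.integral_eq_integral_of_support_subset
      ((Function.support_mul_subset_right _ _).trans hsupp')] at key
  rw [key]
  congr 1
  refine integral_congr_ae ?_
  filter_upwards [LocallyIntegrable.ae_hasDerivAt_integral hg] with x hx
  rw [(hx 0).deriv]

/-- The difference of the classical derivative of order s and the primitive of g is continuous with
vanishing weak derivative, hence constant. -/
theorem HasWeakDeriv.iteratedDeriv_eq_add_integral {s : ℕ} {ψ g : ℝ → ℝ} (hψ : ContDiff ℝ s ψ)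
    (h : HasWeakDeriv (s + 1) ψ g) (z : ℝ) :
    iteratedDeriv s ψ z = iteratedDeriv s ψ 0 + ∫ t in (0 : ℝ)..z, g t := by
  obtain ⟨-, hg, h⟩ := h
  have hc : Continuous (iteratedDeriv s ψ) := hψ.continuous_iteratedDeriv _ le_rfl
  have hG : Continuous fun z => ∫ t in (0 : ℝ)..z, g t :=
    intervalIntegral.continuous_primitive
      (fun a b => (hg.integrableOn_isCompact isCompact_uIcc).intervalIntegrable) 0
  have := (hc.sub hG).eq_of_forall_integral_mul_deriv_eq_zero (fun η hη hs => ?_) z 0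
  · simp only [Pi.sub_apply, intervalIntegral.integral_same, sub_zero] at this
    linarith
  · have hη' : ContDiff ℝ ∞ (deriv η) := (contDiff_infty_iff_deriv.1 hη).2
    have h1 := h η hη hs
    rw [iteratedDeriv_succ', integral_mul_iteratedDeriv_eq hψ hη' hs.deriv, pow_succ, mul_assoc]
      at h1
    have h2 := mul_left_cancel₀ (pow_ne_zero s (by norm_num)) h1
    have h3 := integral_primitive_mul_deriv_eq hg hη hs
    simp only [Pi.sub_apply, sub_mul]
    rw [integral_sub, h2, h3]
    · ring
    · exact (hc.mul hη'.continuous).integrable_of_hasCompactSupport hs.deriv.mul_left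
    · exact (hG.mul hη'.continuous).integrable_of_hasCompactSupport hs.deriv.mul_left

/-! ### Embeddings for smooth Lipschitz activations -/

/-- The weight depends on whether the activation is a rectified power unit. Growth excludes the
orders s ≥ 2 for Lipschitz activations; below, the kink at 0 excludes s = 1 for C¹ ones. -/
theorem not_lipschitzWith_repu {s : ℕ} (hs : 2 ≤ s) (K : ℝ≥0) : ¬ LipschitzWith K (repu s) := by
  intro h
  have h1 := h.dist_le_mul (K + 1) 0
  have hK : (0 : ℝ) ≤ K := K.2
  rw [Real.dist_eq, Real.dist_eq, repu, repu, max_eq_right (by linarith), max_self,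
    zero_pow (by omega), sub_zero, sub_zero, abs_of_nonneg (by positivity),
    abs_of_nonneg (by positivity)] at h1
  have h2 : ((K : ℝ) + 1) ^ 2 ≤ (K + 1) ^ s := pow_le_pow_right₀ (by linarith) hs
  nlinarith

theorem not_contDiff_repu_one : ¬ ContDiff ℝ 1 (repu 1) := by
  intro h
  refine not_differentiableAt_abs_zero ?_
  have : (abs : ℝ → ℝ) = fun x => 2 * repu 1 x - x := by
    ext x
    rcases le_total 0 x with h | h
    · rw [repu, max_eq_right h, abs_of_nonneg h]; ring
    · rw [repu, max_eq_left h, abs_of_nonpos h]; ring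
  rw [this]
  exact (((h.differentiable one_ne_zero) 0).const_mul 2).sub differentiableAt_id

theorem LipschitzWith.barronWeight_eq {d : ℕ} {K : ℝ≥0} {σ : ℝ → ℝ} (h : LipschitzWith K σ)
    (h1 : σ ≠ repu 1) (p : Param d) : barronWeight σ p = 1 + paramNorm p := by
  rw [barronWeight, dif_neg, paramNorm, add_assoc]
  rintro ⟨s, hs, rfl⟩
  rcases hs.eq_or_lt with rfl | hs
  · exact h1 rfl
  · exact not_lipschitzWith_repu hs K h

/-- Integrability of the derivative of order s + 1 makes the shifts cost only its L¹ norm, so the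
growth exponent is m = 0. The remaining weight (1 + R)^s has to be dominated by the source weight 1
+ R on Ω. -/
theorem barronEmbeds_of_weakDerivInL1 {d s : ℕ} (hs : 1 ≤ s) {K : ℝ≥0} {ψ : ℝ → ℝ}
    (hL : LipschitzWith K ψ) (hψ : ContDiff ℝ s ψ) (hw : WeakDerivInL1 (s + 1) ψ)
    {Ω Ω' : Set (Param d)} (hΩ' : Ω' ∈ 𝓝 0) {D : ℝ≥0}
    (hD : ∀ p ∈ Ω, (1 + paramNorm p) ^ s ≤ D * (1 + paramNorm p)) :
    BarronEmbeds Ω ψ Ω' (repu s) := by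
  obtain ⟨g, hgi, hgw⟩ := hw
  have hne : ψ ≠ repu 1 := by
    rintro rfl
    exact not_contDiff_repu_one (hψ.of_le (by exact_mod_cast hs))
  set G := hgi.1.mk g with hG
  have hae : g =ᵐ[volume] G := hgi.1.ae_eq_mk
  have hGi : Integrable G := hgi.congr hae
  have hprim (z : ℝ) : iteratedDeriv s ψ z = iteratedDeriv s ψ 0 + ∫ t in (0 : ℝ)..z, G t := by
    rw [hgw.iteratedDeriv_eq_add_integral hψ z]
    congr 1
    exact intervalIntegral.integral_congr_ae (hae.mono fun x hx _ => hx)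
  obtain ⟨C, hC⟩ := exists_barronNorm_repu_le_of_primitive (d := d) (m := 0) hs hψ
    hgi.1.stronglyMeasurable_mk.measurable hGi.locallyIntegrable hprim
    (∫⁻ t, ‖G t‖ₑ).toNNReal fun r _ => by
      have hfin : ∫⁻ t, ‖G t‖ₑ ≠ ⊤ := hGi.2.ne
      rw [ENNReal.coe_toNNReal hfin, pow_zero, ENNReal.ofReal_one, mul_one]
      exact setLIntegral_le_lintegral _ _
  refine .of_forall_measure (C * D) fun f ν h _ hm habs hf hfin => ?_
  have e (p : Ω) : ‖h p‖ₑ = 1 := by rw [Real.enorm_eq_ofReal_abs, habs]; simp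
  have hle : ∫⁻ p : Ω, ‖h p‖ₑ * ENNReal.ofReal ((1 + paramNorm p.1) ^ (s + 0)) ∂ν ≤
      D * ∫⁻ p : Ω, ENNReal.ofReal (barronWeight ψ p.1) ∂ν := by
    rw [← lintegral_const_mul' _ _ ENNReal.coe_ne_top]
    refine lintegral_mono fun p => ?_
    rw [e, one_mul, add_zero, hL.barronWeight_eq hne, ← ENNReal.ofReal_coe_nnreal (p := D),
      ← ENNReal.ofReal_mul D.coe_nonneg]
    exact ENNReal.ofReal_le_ofReal (hD p p.2)
  refine (hC Ω' hΩ' Ω ν h Subtype.val f hm measurable_subtype_coe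
    (hle.trans_lt (ENNReal.mul_lt_top ENNReal.coe_lt_top hfin)) hf).trans ?_
  rw [ENNReal.coe_mul, mul_assoc]
  gcongr

theorem exists_forall_one_add_paramNorm_pow_le {d s : ℕ} (hs : 1 ≤ s) {Ω : Set (Param d)}
    (hΩ : Bornology.IsBounded Ω) :
    ∃ D : ℝ≥0, ∀ p ∈ Ω, (1 + paramNorm p) ^ s ≤ D * (1 + paramNorm p) := by
  obtain ⟨R, hR⟩ := hΩ.subset_closedBall 0
  obtain ⟨M, hM⟩ := (isCompact_closedBall (0 : Param d) R).exists_bound_of_continuousOn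
    continuous_paramNorm.continuousOn
  refine ⟨Real.toNNReal ((1 + M) ^ (s - 1)), fun p hp => ?_⟩
  have h0 := paramNorm_nonneg p
  have h1 : paramNorm p ≤ M := (le_abs_self _).trans (hM p (hR hp))
  rw [Real.coe_toNNReal _ (pow_nonneg (by linarith) _)]
  obtain ⟨k, rfl⟩ := Nat.exists_eq_add_of_le' hs
  rw [Nat.add_sub_cancel, pow_succ]
  gcongr

/-! ### Changing the activation through a measure on the plane -/

theorem LipschitzWith.abs_le_mul_one_add_abs {K : ℝ≥0} {σ : ℝ → ℝ} (h : LipschitzWith K σ)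
    (y : ℝ) : |σ y| ≤ (|σ 0| + K) * (1 + |y|) := by
  have h1 := h.dist_le_mul y 0
  rw [Real.dist_eq, Real.dist_eq, sub_zero] at h1
  have h2 : |σ y| ≤ |σ y - σ 0| + |σ 0| := by simpa using abs_add_le (σ y - σ 0) (σ 0)
  have h3 : 0 ≤ |σ 0| * |y| := by positivity
  have h4 : (0 : ℝ) ≤ K := K.2
  nlinarith

theorem barronWeight_repu_one {d : ℕ} (p : Param d) : barronWeight (repu 1) p = paramNorm p := by
  rw [barronWeight_repu le_rfl, pow_one, paramNorm]

theorem LipschitzWith.barronWeight_le {d : ℕ} {K : ℝ≥0} {σ : ℝ → ℝ} (h : LipschitzWith K σ)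
    (p : Param d) : barronWeight σ p ≤ 1 + paramNorm p := by
  by_cases h1 : σ = repu 1
  · rw [h1, barronWeight_repu_one]
    linarith
  · rw [h.barronWeight_eq h1]

theorem paramNorm_mul_add_le {d : ℕ} (p : Param d) (q : ℝ × ℝ) :
    1 + paramNorm (d := d) (q.1 • p.1, q.1 * p.2 + q.2) ≤
      (1 + paramNorm p) * (1 + |q.1| + |q.2|) := by
  have h1 : |q.1 * p.2 + q.2| ≤ |q.1| * |p.2| + |q.2| := by
    refine (abs_add_le _ _).trans (le_of_eq ?_)
    rw [abs_mul]
  have h2 := l1norm_nonneg p.1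
  have h3 : 0 ≤ (l1norm p.1 + |p.2|) * (1 + |q.2|) := by positivity
  have h4 := abs_nonneg q.1
  simp only [paramNorm, l1norm_smul]
  nlinarith

/-- Composition of a superposition of `φ`-neurons with a representation of `φ` by `ψ`-neurons. -/
theorem barronNorm_univ_le_of_integral_eq {d : ℕ} {φ ψ : ℝ → ℝ} {K : ℝ≥0} (hψ : LipschitzWith K ψ)
    {γ : Measure (ℝ × ℝ)} [SFinite γ] {k : ℝ × ℝ → ℝ} (hk : Measurable k) (hkabs : ∀ q, |k q| = 1)
    (hγ : ∫⁻ q, ENNReal.ofReal (1 + |q.1| + |q.2|) ∂γ < ⊤)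
    (hφ : ∀ x, φ x = ∫ q, k q * ψ (x * q.1 + q.2) ∂γ)
    {A : Type*} [MeasurableSpace A] {ν : Measure A} [SFinite ν] {h : A → ℝ} (hm : Measurable h)
    {P : A → Param d} (hP : Measurable P)
    (hfin : ∫⁻ a, ‖h a‖ₑ * ENNReal.ofReal (1 + paramNorm (P a)) ∂ν < ⊤) {f : cube d → ℝ}
    (hf : ∀ x : cube d, f x = ∫ a, h a * φ (preact x.1 (P a)) ∂ν) :
    barronNorm Set.univ ψ f ≤ (∫⁻ q, ENNReal.ofReal (1 + |q.1| + |q.2|) ∂γ) *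
      ∫⁻ a, ‖h a‖ₑ * ENNReal.ofReal (1 + paramNorm (P a)) ∂ν := by
  set T : A × (ℝ × ℝ) → Param d := fun z => (z.2.1 • (P z.1).1, z.2.1 * (P z.1).2 + z.2.2) with hT
  set h' : A × (ℝ × ℝ) → ℝ := fun z => h z.1 * k z.2 with hh'
  have hTm : Measurable T := by fun_prop
  have hm' : Measurable h' := by fun_prop
  have e (z : A × (ℝ × ℝ)) : ‖h' z‖ₑ = ‖h z.1‖ₑ := by
    rw [enorm_mul, Real.enorm_eq_ofReal_abs (k _), hkabs]; simp
  have hTR : Measurable fun z => paramNorm (T z) := continuous_paramNorm.measurable.comp hTm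
  have hPR : Measurable fun a => paramNorm (P a) := continuous_paramNorm.measurable.comp hP
  have hle : ∫⁻ z, ‖h' z‖ₑ * ENNReal.ofReal (1 + paramNorm (T z)) ∂(ν.prod γ) ≤
      (∫⁻ q, ENNReal.ofReal (1 + |q.1| + |q.2|) ∂γ) *
        ∫⁻ a, ‖h a‖ₑ * ENNReal.ofReal (1 + paramNorm (P a)) ∂ν := by
    rw [mul_comm, ← lintegral_prod_mul (by fun_prop) (by fun_prop)]
    refine lintegral_mono fun z => ?_
    rw [e, mul_assoc, ← ENNReal.ofReal_mul (by linarith [paramNorm_nonneg (P z.1)])]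
    exact mul_le_mul_right (ENNReal.ofReal_le_ofReal (paramNorm_mul_add_le _ _)) _
  have hfin' := hle.trans_lt (ENNReal.mul_lt_top hγ hfin)
  have hint : Integrable h' (ν.prod γ) := by
    refine ⟨hm'.aestronglyMeasurable, hasFiniteIntegral_iff_enorm.2 (lt_of_le_of_lt ?_ hfin')⟩
    refine lintegral_mono fun z => le_mul_of_one_le_right' ?_
    rw [ENNReal.one_le_ofReal]
    linarith [paramNorm_nonneg (T z)]
  have hψT (x : cube d) : Measurable fun z => ψ (preact x.1 (T z)) :=
    (hψ.continuous.comp (continuous_preact.comp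
      (continuous_const.prodMk continuous_id))).measurable.comp hTm
  have hi (x : cube d) : Integrable (fun z => h' z * ψ (preact x.1 (T z))) (ν.prod γ) := by
    refine ⟨(hm'.mul (hψT x)).aestronglyMeasurable, hasFiniteIntegral_iff_enorm.2 ?_⟩
    have hC : 0 ≤ |ψ 0| + K := by positivity
    refine lt_of_le_of_lt ?_ (ENNReal.mul_lt_top (ENNReal.ofReal_lt_top (r := |ψ 0| + K)) hfin')
    rw [← lintegral_const_mul' _ _ ENNReal.ofReal_ne_top]
    refine lintegral_mono fun z => ?_
    rw [enorm_mul, mul_left_comm, ← ENNReal.ofReal_mul hC, Real.enorm_eq_ofReal_abs (ψ _)]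
    refine mul_le_mul_right (ENNReal.ofReal_le_ofReal ?_) _
    refine (hψ.abs_le_mul_one_add_abs _).trans ?_
    gcongr
    exact abs_preact_le x _
  refine (barronNorm_le_lintegral _ hm' hint hTm (fun _ => Set.mem_univ _) hψ.continuous hi
    fun x => ?_).trans (le_trans (lintegral_mono fun z => ?_) hle)
  · rw [hf x, integral_prod _ (hi x)]
    refine integral_congr_ae (.of_forall fun a => ?_)
    simp only [hφ, hh', hT, preact_affine]
    rw [← integral_const_mul]
    refine integral_congr_ae (.of_forall fun q => ?_)
    ring_nf
  · exact mul_le_mul_right (ENNReal.ofReal_le_ofReal (hψ.barronWeight_le _)) _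

theorem barronEmbeds_of_integral_eq {d : ℕ} {φ ψ : ℝ → ℝ} {K K' : ℝ≥0} (hφ : LipschitzWith K φ)
    (hψ : LipschitzWith K' ψ) {γ : SignedMeasure (ℝ × ℝ)}
    (hγ : ∫⁻ q : ℝ × ℝ, ENNReal.ofReal (1 + |q.1| + |q.2|) ∂γ.variation < ⊤)
    (hrep : ∀ x : ℝ, φ x = ∫ᵛ q : ℝ × ℝ, ψ (x * q.1 + q.2) ∂<•γ) (Ω : Set (Param d)) :
    BarronEmbeds Ω φ Set.univ ψ := by
  have : IsFiniteMeasure γ.variation := by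
    rw [← SignedMeasure.totalVariation_eq_variation, SignedMeasure.totalVariation]
    infer_instance
  obtain ⟨k, hk, hkabs, hkint⟩ := SignedMeasure.exists_density_variation γ
  have hi (x : ℝ) : Integrable (fun q : ℝ × ℝ => ψ (x * q.1 + q.2)) γ.variation := by
    have h1 : Integrable (fun q : ℝ × ℝ => (|ψ 0| + K') * (1 + |x|) * (1 + |q.1| + |q.2|))
        γ.variation := by
      refine Integrable.const_mul ⟨by fun_prop, hasFiniteIntegral_iff_enorm.2 ?_⟩ _
      refine lt_of_le_of_lt (lintegral_mono fun q => le_of_eq ?_) hγ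
      exact Real.enorm_of_nonneg (by positivity)
    refine h1.mono' (hψ.continuous.comp (by fun_prop)).aestronglyMeasurable (.of_forall fun q => ?_)
    rw [Real.norm_eq_abs]
    refine (hψ.abs_le_mul_one_add_abs _).trans ?_
    rw [mul_assoc]
    refine mul_le_mul_of_nonneg_left ?_ (by positivity)
    have h2 : |x * q.1 + q.2| ≤ |x| * |q.1| + |q.2| := by
      refine (abs_add_le _ _).trans (le_of_eq ?_)
      rw [abs_mul]
    have h3 : 0 ≤ |x| * (1 + |q.2|) := by positivity
    nlinarith [abs_nonneg q.1]
  have hφk (x : ℝ) : φ x = ∫ q, k q * ψ (x * q.1 + q.2) ∂γ.variation := by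
    rw [hrep x, hkint _ (hi x)]
  obtain ⟨G, hG⟩ : ∃ G : ℝ≥0,
      (G : ENNReal) = ∫⁻ q : ℝ × ℝ, ENNReal.ofReal (1 + |q.1| + |q.2|) ∂γ.variation :=
    ⟨_, ENNReal.coe_toNNReal hγ.ne⟩
  -- The ReLU has source weight R instead of 1 + R, which does not control neurons with small
  -- parameters. Homogeneity first moves these to norm at most 1, where 1 + R ≤ 2; hence the factor
  -- 2.
  by_cases h1 : φ = repu 1
  · subst h1
    refine .of_forall_measure (G * 2) fun f ν h _ hm habs hf hfin => ?_
    have e (p : Ω) : ‖h p‖ₑ = 1 := by rw [Real.enorm_eq_ofReal_abs, habs]; simp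
    simp only [barronWeight_repu_one] at hfin ⊢
    have hR : Measurable fun p : Ω => paramNorm p.1 :=
      continuous_paramNorm.measurable.comp measurable_subtype_coe
    set h' : Ω → ℝ := fun p => h p * paramNorm p.1 with hh'
    set P : Ω → Param d := fun p => (paramNorm p.1)⁻¹ • p.1 with hP
    have hnorm (p : Ω) : paramNorm (P p) ≤ 1 := by
      rw [hP, paramNorm_smul, abs_of_nonneg (inv_nonneg.2 (paramNorm_nonneg _))]
      exact inv_mul_le_one
    have hpt (p : Ω) (x : cube d) :
        h' p * repu 1 (preact x.1 (P p)) = h p * repu 1 (preact x.1 p) := by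
      rcases (paramNorm_nonneg p.1).eq_or_lt with h0 | h0
      · simp only [hh', hP]
        rw [← h0, eq_zero_of_paramNorm_eq_zero h0.symm]
        simp [preact, repu]
      · simp only [hh', hP]
        rw [preact_smul, repu_mul _ (by positivity), pow_one, mul_assoc,
          mul_inv_cancel_left₀ h0.ne']
    have hle : ∫⁻ p, ‖h' p‖ₑ * ENNReal.ofReal (1 + paramNorm (P p)) ∂ν ≤
        2 * ∫⁻ p : Ω, ENNReal.ofReal (paramNorm p.1) ∂ν := by
      rw [← lintegral_const_mul' _ _ (by simp)]
      refine lintegral_mono fun p => ?_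
      rw [enorm_mul, e, one_mul, Real.enorm_of_nonneg (paramNorm_nonneg _), mul_comm]
      gcongr
      refine ENNReal.ofReal_le_of_le_toReal ?_
      rw [ENNReal.toReal_ofNat]
      linarith [hnorm p]
    refine (barronNorm_univ_le_of_integral_eq hψ hk hkabs hγ hφk (hm.mul hR)
      (hR.inv.smul measurable_subtype_coe) (hle.trans_lt (ENNReal.mul_lt_top (by simp) hfin))
      fun x => ?_).trans ?_
    · rw [hf x]
      exact integral_congr_ae (.of_forall fun p => (hpt p x).symm)
    · rw [← hG, ENNReal.coe_mul, mul_assoc]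
      exact mul_le_mul_right hle _
  · refine .of_forall_measure G fun f ν h _ hm habs hf hfin => ?_
    have e (p : Ω) : ‖h p‖ₑ = 1 := by rw [Real.enorm_eq_ofReal_abs, habs]; simp
    simp only [hφ.barronWeight_eq h1] at hfin ⊢
    have := barronNorm_univ_le_of_integral_eq hψ hk hkabs hγ hφk hm
      (measurable_subtype_coe (p := (· ∈ Ω))) (by simpa only [e, one_mul] using hfin) hf
    simpa only [e, one_mul, hG] using this

/-! ### Fourier inversion for integrable functions with integrable transform -/

open scoped FourierTransform in
/-- Fourier inversion almost everywhere, without continuity of the function. -/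
theorem MeasureTheory.Integrable.ae_eq_fourierInv_fourier {V : Type*} [NormedAddCommGroup V]
    [InnerProductSpace ℝ V] [FiniteDimensional ℝ V] [MeasurableSpace V] [BorelSpace V] {f : V → ℂ}
    (hf : Integrable f) (hf' : Integrable (𝓕 f)) : f =ᵐ[volume] 𝓕⁻ (𝓕 f) := by
  have hcont {g : V → ℂ} (hg : Integrable g) : Continuous (𝓕 g) :=
    VectorFourier.fourierIntegral_continuous (L := innerₗ V) Real.continuous_fourierChar
      continuous_inner hg
  have hadj {g k : V → ℂ} (hg : Integrable g) (hk : Integrable k) :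
      ∫ x, 𝓕 g x • k x = ∫ x, g x • 𝓕 k x := by
    simpa using! VectorFourier.integral_fourierIntegral_smul_eq_flip (L := innerₗ V)
      Real.continuous_fourierChar continuous_inner hg hk
  have hc : Continuous (𝓕⁻ (𝓕 f)) := by
    have : 𝓕⁻ (𝓕 f) = fun x => 𝓕 (𝓕 f) (-x) := funext fun x => Real.fourierInv_eq_fourier_neg _ _
    rw [this]
    exact (hcont hf').comp continuous_neg
  refine ae_eq_of_integral_contDiff_smul_eq hf.locallyIntegrable hc.locallyIntegrable
    fun g hg hgs => ?_
  -- Test functions are Schwartz functions, for which inversion holds. Two applications of ∫ 𝓕g · k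
  -- = ∫ g · 𝓕k transfer it to f.
  let φ : SchwartzMap V ℂ := HasCompactSupport.toSchwartzMap (f := fun x => (g x : ℂ))
    (hgs.comp_left (g := fun r : ℝ => (r : ℂ)) Complex.ofReal_zero)
    (Complex.ofRealCLM.contDiff.comp hg)
  have hφ (x : V) : φ x = (g x : ℂ) := rfl
  have hφi : Integrable (φ : V → ℂ) := φ.integrable
  have hinvi : Integrable (𝓕⁻ (φ : V → ℂ)) := by
    rw [← SchwartzMap.fourierInv_coe]; exact (𝓕⁻ φ).integrable
  have hinv : 𝓕 (𝓕⁻ (φ : V → ℂ)) = φ := by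
    rw [← SchwartzMap.fourierInv_coe, ← SchwartzMap.fourier_coe,
      FourierTransform.fourier_fourierInv_eq]
  calc ∫ x, g x • f x = ∫ x, 𝓕 (𝓕⁻ (φ : V → ℂ)) x • f x := by
        rw [hinv]; simp [hφ]
    _ = ∫ x, 𝓕⁻ (φ : V → ℂ) x • 𝓕 f x := hadj hinvi hf
    _ = ∫ x, 𝓕 (fun x => φ (-x)) x • 𝓕 f x := by rw [Real.fourierInv_eq_fourier_comp_neg]
    _ = ∫ x, φ (-x) • 𝓕 (𝓕 f) x := hadj hφi.comp_neg hf'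
    _ = ∫ x, φ x • 𝓕 (𝓕 f) (-x) := by
        rw [← integral_neg_eq_self]; simp
    _ = ∫ x, g x • 𝓕⁻ (𝓕 f) x := by
        simp [hφ, Real.fourierInv_eq_fourier_neg]

open scoped FourierTransform in
theorem fourierHat_eq {d : ℕ} (F : EuclideanSpace ℝ (Fin d) → ℂ) (ξ : EuclideanSpace ℝ (Fin d)) :
    fourierHat F ξ = (((2 * Real.pi) ^ d)⁻¹ : ℝ) * 𝓕 F ((2 * Real.pi)⁻¹ • ξ) := by
  rw [fourierHat, Real.fourier_eq']
  congr 1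
  refine integral_congr_ae (.of_forall fun x => ?_)
  simp only [smul_eq_mul, inner_smul_right]
  congr 2
  push_cast
  have : (Real.pi : ℂ) ≠ 0 := by exact_mod_cast Real.pi_ne_zero
  field_simp

open scoped FourierTransform in
theorem fourier_eq_fourierHat {d : ℕ} (F : EuclideanSpace ℝ (Fin d) → ℂ)
    (v : EuclideanSpace ℝ (Fin d)) :
    𝓕 F v = ((2 * Real.pi) ^ d : ℝ) * fourierHat F ((2 * Real.pi) • v) := by
  have h2 : (2 * Real.pi) ≠ 0 := by positivity
  rw [fourierHat_eq, smul_smul, inv_mul_cancel₀ h2, one_smul, ← mul_assoc, ← Complex.ofReal_mul,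
    mul_inv_cancel₀ (pow_ne_zero _ h2), Complex.ofReal_one, one_mul]

theorem continuous_fourierHat {d : ℕ} {F : EuclideanSpace ℝ (Fin d) → ℂ} (hF : Integrable F) :
    Continuous (fourierHat F) := by
  have h1 : Continuous (FourierTransform.fourier F) :=
    VectorFourier.fourierIntegral_continuous (L := innerₗ (EuclideanSpace ℝ (Fin d)))
      Real.continuous_fourierChar continuous_inner hF
  have : fourierHat F = fun ξ => (((2 * Real.pi) ^ d)⁻¹ : ℝ) *
      FourierTransform.fourier F ((2 * Real.pi)⁻¹ • ξ) := funext (fourierHat_eq F)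
  rw [this]
  exact continuous_const.mul (h1.comp (continuous_const_smul _))

/-- Fourier inversion for the normalization `(2π)^{-d}` of the Fourier transform. -/
theorem ae_eq_integral_fourierHat {d : ℕ} {F : EuclideanSpace ℝ (Fin d) → ℂ} (hF : Integrable F)
    (hF' : Integrable (fourierHat F)) :
    ∀ᵐ x, F x = ∫ ξ, Complex.exp (((inner ℝ x ξ : ℝ) : ℂ) * Complex.I) * fourierHat F ξ := by
  have h2 : (2 * Real.pi) ≠ 0 := by positivity
  have hi : Integrable (FourierTransform.fourier F) := by
    have : FourierTransform.fourier F =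
        fun v => ((2 * Real.pi) ^ d : ℝ) * fourierHat F ((2 * Real.pi) • v) :=
      funext (fourier_eq_fourierHat F)
    rw [this]
    exact (hF'.comp_smul h2).const_mul _
  filter_upwards [hF.ae_eq_fourierInv_fourier hi] with x hx
  rw [hx, Real.fourierInv_eq']
  set H : EuclideanSpace ℝ (Fin d) → ℂ := fun ξ =>
    Complex.exp (((inner ℝ x ξ : ℝ) : ℂ) * Complex.I) * fourierHat F ξ with hH
  have e (v : EuclideanSpace ℝ (Fin d)) :
      Complex.exp (((2 * Real.pi * inner ℝ v x : ℝ) : ℂ) * Complex.I) • FourierTransform.fourier F v =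
        ((2 * Real.pi) ^ d : ℝ) * H ((2 * Real.pi) • v) := by
    simp only [hH]
    rw [fourier_eq_fourierHat, inner_smul_right, real_inner_comm, smul_eq_mul]
    ring
  simp_rw [e]
  rw [integral_const_mul, Measure.integral_comp_smul, finrank_euclideanSpace, Fintype.card_fin,
    abs_of_nonneg (by positivity), Complex.real_smul, ← mul_assoc, ← Complex.ofReal_mul,
    mul_inv_cancel₀ (pow_ne_zero _ h2), Complex.ofReal_one, one_mul]

/-! ### Uniqueness of the continuous representative on the cube -/

theorem isClosed_cube (d : ℕ) : IsClosed (cube d) := by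
  simp only [cube, Set.ofPred_forall]
  exact isClosed_iInter fun i => isClosed_le (by fun_prop) continuous_const

theorem convex_cube (d : ℕ) : Convex ℝ (cube d) := by
  intro x hx y hy a b ha hb hab i
  simp only [PiLp.add_apply, PiLp.smul_apply, smul_eq_mul]
  refine (abs_add_le _ _).trans ?_
  rw [abs_mul, abs_mul, abs_of_nonneg ha, abs_of_nonneg hb]
  nlinarith [hx i, hy i]

theorem interior_cube_nonempty (d : ℕ) : (interior (cube d)).Nonempty := by
  refine ⟨0, mem_interior.2 ⟨Metric.ball 0 1, fun x hx i => ?_, Metric.isOpen_ball,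
    Metric.mem_ball_self one_pos⟩⟩
  rw [mem_ball_zero_iff] at hx
  exact (PiLp.norm_apply_le x i).trans hx.le

/-- The cube is the closure of its interior, so each nonempty relatively open subset contains a
nonempty open set of ℝ^d. Continuous functions equal almost everywhere on the cube are therefore
equal. -/
instance isOpenPosMeasure_cubeMeasure (d : ℕ) : (cubeMeasure d).IsOpenPosMeasure := by
  refine ⟨fun U hU hne => ?_⟩
  obtain ⟨V, hV, rfl⟩ := isOpen_induced_iff.1 hU
  obtain ⟨x, hx⟩ := hne
  have hcl : closure (interior (cube d)) = cube d := by
    rw [(convex_cube d).closure_interior_eq_closure_of_nonempty_interior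
      (interior_cube_nonempty d), (isClosed_cube d).closure_eq]
  have hxc : x.1 ∈ closure (interior (cube d)) := by rw [hcl]; exact x.2
  obtain ⟨y, hyV, hyI⟩ := mem_closure_iff.1 hxc V hV hx
  rw [cubeMeasure, comap_subtype_coe_apply (isClosed_cube d).measurableSet]
  refine (lt_of_lt_of_le ((hV.inter isOpen_interior).measure_pos volume ⟨y, hyV, hyI⟩)
    (measure_mono ?_)).ne'
  intro z hz
  exact ⟨⟨z, interior_subset hz.2⟩, hz.1, rfl⟩

theorem ae_cubeMeasure_of_ae {d : ℕ} {p : EuclideanSpace ℝ (Fin d) → Prop} (h : ∀ᵐ x, p x) :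
    ∀ᵐ x ∂cubeMeasure d, p x.1 := by
  refine ae_of_ae_map measurable_subtype_coe.aemeasurable ?_
  rw [cubeMeasure, (MeasurableEmbedding.subtype_coe (isClosed_cube d).measurableSet).map_comap]
  exact ae_restrict_of_ae h

/-- Dominated convergence: R^s bounds the neurons on the cube and is integrable for a representation
of finite weight. -/
theorem continuous_of_mem_barronSpace_repu {d s : ℕ} (hs : 1 ≤ s) {Ω : Set (Param d)}
    {f : cube d → ℝ} (hf : f ∈ barronSpace Ω (repu s)) : Continuous f := by
  obtain ⟨μ, hμ⟩ := iInf_lt_iff.1 (show barronNorm Ω (repu s) f < ⊤ from hf)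
  obtain ⟨hμr, hμ⟩ := iInf_lt_iff.1 hμ
  obtain ⟨h, hm, habs, hh⟩ := exists_density_of_represents hμr
  have hfun : f = fun x => ∫ p : Ω, h p * repu s (preact x.1 p) ∂μ.variation := funext hh
  have hR : Measurable fun p : Ω => paramNorm p.1 ^ s :=
    (continuous_paramNorm.measurable.comp measurable_subtype_coe).pow_const s
  have hcont := (continuous_repu s).comp (continuous_preact (d := d))
  rw [hfun]
  refine continuous_of_dominated (bound := fun p : Ω => paramNorm p.1 ^ s) (fun x => ?_)
    (fun x => .of_forall fun p => ?_) ?_ (.of_forall fun p => ?_)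
  · exact (hm.mul ((hcont.comp (continuous_const.prodMk
      continuous_subtype_val)).measurable)).aestronglyMeasurable
  · rw [norm_mul, Real.norm_eq_abs, habs, one_mul]
    exact abs_repu_preact_le s x p.1
  · refine ⟨hR.aestronglyMeasurable, hasFiniteIntegral_iff_enorm.2 (lt_of_le_of_lt ?_ hμ)⟩
    refine lintegral_mono fun p => ?_
    rw [barronWeight_repu hs, Real.enorm_of_nonneg (pow_nonneg (paramNorm_nonneg _) _), paramNorm]
  · exact continuous_const.mul (hcont.comp (continuous_subtype_val.prodMk continuous_const))

/-! ### Spectral Barron spaces -/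

/-- The growth condition of `exists_barronNorm_repu_le_of_primitive` for smooth activations with
bounded derivatives. -/
theorem exists_barronNorm_repu_le_of_abs_iteratedDeriv_le {d s : ℕ} (hs : 1 ≤ s) {ψ : ℝ → ℝ}
    (hψ : ContDiff ℝ ∞ ψ) (hb : ∀ x, |iteratedDeriv (s + 1) ψ x| ≤ 1) :
    ∃ C : ℝ≥0, ∀ (Ω : Set (Param d)), Ω ∈ 𝓝 0 → ∀ (A : Type) [MeasurableSpace A] (ν : Measure A)
      [SFinite ν] (h : A → ℝ) (P : A → Param d) (f : cube d → ℝ), Measurable h → Measurable P →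
      ∫⁻ a, ‖h a‖ₑ * ENNReal.ofReal ((1 + paramNorm (P a)) ^ (s + 1)) ∂ν < ⊤ →
      (∀ x : cube d, f x = ∫ a, h a * ψ (preact x.1 (P a)) ∂ν) →
      barronNorm Ω (repu s) f ≤
        C * ∫⁻ a, ‖h a‖ₑ * ENNReal.ofReal ((1 + paramNorm (P a)) ^ (s + 1)) ∂ν := by
  have hc : Continuous (iteratedDeriv (s + 1) ψ) :=
    hψ.continuous_iteratedDeriv _ (by exact_mod_cast le_top)
  -- A derivative bounded by 1 has integral at most 2r ≤ 2(1 + r) over [-r, r], which gives B = 2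
  -- and m = 1.
  refine exists_barronNorm_repu_le_of_primitive hs (hψ.of_le (by exact_mod_cast le_top))
    hc.measurable hc.locallyIntegrable (fun z => ?_) 2 fun r hr => ?_
  · rw [intervalIntegral.integral_eq_sub_of_hasDerivAt (f := iteratedDeriv s ψ) (fun x _ => ?_)
      (hc.intervalIntegrable _ _)]
    · ring
    · rw [iteratedDeriv_succ]
      exact (hψ.differentiable_iteratedDeriv s (by exact_mod_cast ENat.natCast_lt_top s) x).hasDerivAt
  · calc ∫⁻ t in Set.Icc (-r) r, ‖iteratedDeriv (s + 1) ψ t‖ₑ ≤ ∫⁻ t in Set.Icc (-r) r, 1 := by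
          refine lintegral_mono fun t => ?_
          rw [Real.enorm_eq_ofReal_abs]
          exact ENNReal.ofReal_le_one.2 (hb t)
      _ = ENNReal.ofReal (r - -r) := by simp
      _ ≤ ((2 : ℝ≥0) : ENNReal) * ENNReal.ofReal ((1 + r) ^ 1) := by
          have : ((2 : ℝ≥0) : ENNReal) = ENNReal.ofReal 2 := by simp
          rw [this, ← ENNReal.ofReal_mul (by norm_num)]
          exact ENNReal.ofReal_le_ofReal (by linarith)

theorem spectralEmbeds_repu {d s : ℕ} (hs : 1 ≤ s) {Ω : Set (Param d)} (hΩ : Ω ∈ 𝓝 0) :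
    SpectralEmbeds (s + 1) Ω (repu s) := by
  obtain ⟨C₁, hC₁⟩ := exists_barronNorm_repu_le_of_abs_iteratedDeriv_le (d := d) hs
    Real.contDiff_cos (Real.abs_iteratedDeriv_cos_le_one _)
  obtain ⟨C₂, hC₂⟩ := exists_barronNorm_repu_le_of_abs_iteratedDeriv_le (d := d) hs
    Real.contDiff_sin (Real.abs_iteratedDeriv_sin_le_one _)
  have key (f : Lp ℝ 1 (cubeMeasure d)) (F : EuclideanSpace ℝ (Fin d) → ℂ)
      (hF : IsL1Extension f F)
      (hfin : ∫⁻ ξ, ENNReal.ofReal ((1 + l1norm ξ) ^ (s + 1)) * ‖fourierHat F ξ‖ₑ < ⊤) :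
      ∃ g : cube d → ℝ, g =ᵐ[cubeMeasure d] f ∧ barronNorm Ω (repu s) g ≤
        (C₁ + C₂ : ℝ≥0) * ∫⁻ ξ, ENNReal.ofReal ((1 + l1norm ξ) ^ (s + 1)) * ‖fourierHat F ξ‖ₑ := by
    set M := ∫⁻ ξ, ENNReal.ofReal ((1 + l1norm ξ) ^ (s + 1)) * ‖fourierHat F ξ‖ₑ with hM
    have hcont := continuous_fourierHat hF.1
    have hint : Integrable (fourierHat F) := by
      refine ⟨hcont.aestronglyMeasurable, hasFiniteIntegral_iff_enorm.2 (lt_of_le_of_lt ?_ hfin)⟩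
      refine lintegral_mono fun ξ => le_mul_of_one_le_left' ?_
      rw [ENNReal.one_le_ofReal]
      exact one_le_pow₀ (by linarith [l1norm_nonneg ξ])
    set P : EuclideanSpace ℝ (Fin d) → Param d := fun ξ => (ξ, 0) with hP
    have hPm : Measurable P := by fun_prop
    have hpre (x : cube d) (ξ : EuclideanSpace ℝ (Fin d)) : preact x.1 (P ξ) = inner ℝ x.1 ξ := by
      simp [preact, hP]
    have hPR (ξ : EuclideanSpace ℝ (Fin d)) : paramNorm (P ξ) = l1norm ξ := by
      simp [paramNorm, hP]
    have hre : Measurable fun ξ => (fourierHat F ξ).re := (Complex.continuous_re.comp hcont).measurable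
    have him : Measurable fun ξ => -(fourierHat F ξ).im :=
      (Complex.continuous_im.comp hcont).neg.measurable
    have hle₁ : ∫⁻ ξ, ‖(fourierHat F ξ).re‖ₑ * ENNReal.ofReal ((1 + paramNorm (P ξ)) ^ (s + 1)) ≤ M := by
      refine lintegral_mono fun ξ => ?_
      rw [hPR, mul_comm]
      refine mul_le_mul_right (enorm_le_iff_norm_le.2 ?_) _
      exact Complex.abs_re_le_norm _
    have hle₂ : ∫⁻ ξ, ‖-(fourierHat F ξ).im‖ₑ * ENNReal.ofReal ((1 + paramNorm (P ξ)) ^ (s + 1)) ≤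
        M := by
      refine lintegral_mono fun ξ => ?_
      rw [hPR, mul_comm, enorm_neg]
      refine mul_le_mul_right (enorm_le_iff_norm_le.2 ?_) _
      exact Complex.abs_im_le_norm _
    -- Since f is real, only the real part Re F̂ cos - Im F̂ sin of the inversion integrand is
    -- needed. The frequency ξ is the weight and the bias is 0.
    set g₁ : cube d → ℝ := fun x => ∫ ξ, (fourierHat F ξ).re * Real.cos (preact x.1 (P ξ)) with hg₁
    set g₂ : cube d → ℝ := fun x => ∫ ξ, -(fourierHat F ξ).im * Real.sin (preact x.1 (P ξ)) with hg₂
    have h₁ := hC₁ Ω hΩ _ volume _ P g₁ hre hPm (hle₁.trans_lt hfin) fun x => rfl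
    have h₂ := hC₂ Ω hΩ _ volume _ P g₂ him hPm (hle₂.trans_lt hfin) fun x => rfl
    refine ⟨g₁ + g₂, ?_, ?_⟩
    · filter_upwards [hF.2, ae_cubeMeasure_of_ae (ae_eq_integral_fourierHat hF.1 hint)]
        with x hx hx'
      have hix : Continuous fun ξ => preact x.1 (P ξ) :=
        continuous_preact.comp (continuous_const.prodMk (by fun_prop))
      have hi : Integrable fun ξ =>
          Complex.exp (((inner ℝ x.1 ξ : ℝ) : ℂ) * Complex.I) * fourierHat F ξ := by
        refine hint.bdd_mul (c := 1) (by fun_prop) (.of_forall fun ξ => ?_)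
        rw [Complex.norm_exp_ofReal_mul_I]
      have hi₁ : Integrable fun ξ => (fourierHat F ξ).re * Real.cos (preact x.1 (P ξ)) :=
        hint.re.mul_bdd (c := 1) (Real.continuous_cos.comp hix).aestronglyMeasurable
          (.of_forall fun ξ => Real.abs_cos_le_one _)
      have hi₂ : Integrable fun ξ => -(fourierHat F ξ).im * Real.sin (preact x.1 (P ξ)) :=
        hint.im.neg.mul_bdd (c := 1) (Real.continuous_sin.comp hix).aestronglyMeasurable
          (.of_forall fun ξ => Real.abs_sin_le_one _)
      have hre' := congrArg Complex.re (hx.symm.trans hx')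
      rw [Complex.ofReal_re, ← RCLike.re_eq_complex_re, ← integral_re hi] at hre'
      rw [hre', Pi.add_apply, hg₁, hg₂, ← integral_add hi₁ hi₂]
      refine integral_congr_ae (.of_forall fun ξ => ?_)
      simp only [RCLike.re_eq_complex_re, Complex.mul_re, Complex.exp_ofReal_mul_I_re,
        Complex.exp_ofReal_mul_I_im, hpre]
      ring
    · rw [ENNReal.coe_add, add_mul]
      refine (barronNorm_add_le _ _ _ _).trans (add_le_add (h₁.trans ?_) (h₂.trans ?_))
      · exact mul_le_mul_right hle₁ _
      · exact mul_le_mul_right hle₂ _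
  have huniq {f : Lp ℝ 1 (cubeMeasure d)} {g g' : cube d → ℝ} (hg : g ∈ barronSpace Ω (repu s))
      (hg' : g' ∈ barronSpace Ω (repu s)) (hgf : g =ᵐ[cubeMeasure d] f)
      (hgf' : g' =ᵐ[cubeMeasure d] f) : g = g' :=
    ((continuous_of_mem_barronSpace_repu hs hg).ae_eq_iff_eq _
      (continuous_of_mem_barronSpace_repu hs hg')).1 (hgf.trans hgf'.symm)
  refine ⟨fun f hf => ?_, C₁ + C₂ + 1, fun f hf g hg hgf => ?_⟩
  · obtain ⟨F, hF⟩ := iInf_lt_iff.1 (show spectralBarronNorm (s + 1) f < ⊤ from hf)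
    obtain ⟨hFe, hF⟩ := iInf_lt_iff.1 hF
    obtain ⟨g, hgf, hg⟩ := key f F hFe hF
    have hgs : g ∈ barronSpace Ω (repu s) :=
      hg.trans_lt (ENNReal.mul_lt_top ENNReal.coe_lt_top hF)
    exact ⟨g, ⟨hgs, hgf⟩, fun g' hg' => huniq hg'.1 hgs hg'.2 hgf⟩
  -- Uniqueness makes g the function built from each extension, so the bound holds for all of them
  -- and passes to the infimum. The additional 1 keeps the constant nonzero.
  · have hC : ((C₁ + C₂ + 1 : ℝ≥0) : ENNReal) ≠ 0 := by positivity
    rw [spectralBarronNorm]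
    simp only [ENNReal.mul_iInf_of_ne hC ENNReal.coe_ne_top]
    refine le_iInf₂ fun F hF => ?_
    rcases eq_or_ne (∫⁻ ξ, ENNReal.ofReal ((1 + l1norm ξ) ^ (s + 1)) * ‖fourierHat F ξ‖ₑ) ⊤
      with ht | ht
    · rw [ht, ENNReal.mul_top hC]; exact le_top
    obtain ⟨g', hgf', hg'⟩ := key f F hF ht.lt_top
    have hgs' : g' ∈ barronSpace Ω (repu s) :=
      hg'.trans_lt (ENNReal.mul_lt_top ENNReal.coe_lt_top ht.lt_top)
    rw [huniq hg hgs' hgf hgf']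
    refine hg'.trans (mul_le_mul_left ?_ _)
    exact_mod_cast le_self_add

theorem theorem1 (d : ℕ) (hd : 1 ≤ d) :
    -- part 1: the two Lipschitz activations are related by a measure on the plane
    (∀ (φ ψ : ℝ → ℝ), (∃ K : ℝ≥0, LipschitzWith K φ) → (∃ K : ℝ≥0, LipschitzWith K ψ) →
      ∀ γ : SignedMeasure (ℝ × ℝ),
        ∫⁻ q : ℝ × ℝ, ENNReal.ofReal (1 + |q.1| + |q.2|) ∂γ.variation < ⊤ →
        (∀ x : ℝ, φ x = ∫ᵛ q : ℝ × ℝ, ψ (x * q.1 + q.2) ∂<•γ) →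
        ∀ Ω : Set (Param d), MeasurableSet Ω → BarronEmbeds Ω φ Set.univ ψ) ∧
    -- part 2
    (∀ ψ : ℝ → ℝ, (∃ K : ℝ≥0, LipschitzWith K ψ) → ContDiff ℝ 1 ψ → WeakDerivInL1 2 ψ →
      ∀ Ω Ω' : Set (Param d), MeasurableSet Ω → MeasurableSet Ω' → Ω' ∈ 𝓝 0 →
        BarronEmbeds Ω ψ Ω' (repu 1)) ∧
    -- part 3
    (∀ s : ℕ, 1 ≤ s → ∀ ψ : ℝ → ℝ, (∃ K : ℝ≥0, LipschitzWith K ψ) → ContDiff ℝ s ψ →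
      WeakDerivInL1 (s + 1) ψ →
      ∀ Ω Ω' : Set (Param d), MeasurableSet Ω → MeasurableSet Ω' → Bornology.IsBounded Ω →
        Ω' ∈ 𝓝 0 → BarronEmbeds Ω ψ Ω' (repu s)) ∧
    -- part 4
    (∀ s t : ℕ, 1 ≤ t → t ≤ s →
      ∀ Ω Ω' : Set (Param d), MeasurableSet Ω → MeasurableSet Ω' → Ω' ∈ 𝓝 0 →
        BarronEmbeds Ω (repu s) Ω' (repu t)) ∧
    -- part 5
    (∀ s : ℕ, 1 ≤ s → ∀ Ω' : Set (Param d), MeasurableSet Ω' → Ω' ∈ 𝓝 0 →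
      SpectralEmbeds (s + 1) Ω' (repu s)) := by
  refine ⟨?_, ?_, ?_, ?_, ?_⟩
  · rintro φ ψ ⟨K, hφ⟩ ⟨K', hψ⟩ γ hγ hrep Ω -
    exact barronEmbeds_of_integral_eq hφ hψ hγ hrep Ω
  · rintro ψ ⟨K, hψ⟩ hc hw Ω Ω' - - hΩ'
    -- For s = 1 the required and available weights coincide, so Ω may be unbounded.
    exact barronEmbeds_of_weakDerivInL1 le_rfl hψ (by exact_mod_cast hc) hw hΩ' (D := 1)
      fun p _ => by simp
  · rintro s hs ψ ⟨K, hψ⟩ hc hw Ω Ω' - - hb hΩ'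
    obtain ⟨D, hD⟩ := exists_forall_one_add_paramNorm_pow_le hs hb
    exact barronEmbeds_of_weakDerivInL1 hs hψ hc hw hΩ' hD
  · intro s t ht hts Ω Ω' _ _ hΩ'
    exact barronEmbeds_repu_of_le ht hts Ω hΩ'
  · intro s hs Ω' _ hΩ'
    exact spectralEmbeds_repu hs hΩ'
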